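/- All graphs are finite, simple and undirected. A $k$-colouring of a graph $G=(V,E)$ is a map $c:V\to\{1,\dots,k\}$ with $c(u)\neq c(v)$ for all adjacent $u,v$. For a graph $H$, the graph $G$ is $H$-free if $G$ has no induced subgraph isomorphic to $H$. Colouring-or-Subgraph is the following decision problem: given a graph $G$ on $n\ge 1$ vertices, with $p=\lceil\sqrt{\log_2 n}\,\rceil$, is it true that $G$ is $p$-colourable or that there is a graph $H$ with $|V(H)|\le p$ such that $G$ is $H$-free? A graph on the vertices $0,\dots,n-1$ is encoded as the binary string $1^n0$ followed by the rows of its adjacency matrix, and the problem is identified with the language of the encodings of its yes-instances. A language $L\subseteq\{0,1\}^*$ is in $\Sigma_2^{\mathrm P}$ if there exist a polynomial-time predicate $P$ and a polynomial $q$ such that, for every $x\in\{0,1\}^*$, we have $x\in L$ if and only if there exists a string $y\in\{0,1\}^{q(|x|)}$ such that for every string $z\in\{0,1\}^{q(|x|)}$, $P(x,y,z)=1$. **Theorem.** Colouring-or-Subgraph is in $\Sigma_2^{\mathrm P}$. -/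

import Mathlib

/-- The word `x#y#z` over the alphabet `{0, 1, #}` (with `#` rendered as `none`): the form in which
a triple of binary strings is given to a Turing machine. -/
def encodeTriple (w : List Bool × List Bool × List Bool) : List (Option Bool) :=
  w.1.map some ++ none :: (w.2.1.map some ++ none :: w.2.2.map some)

/-- A predicate on triples of binary strings that a deterministic (multi-stack) Turing machine
decides in time polynomial in the length of the input word `x#y#z`. -/
def IsPolyTimePredicate (P : List Bool × List Bool × List Bool → Bool) : Prop :=
  Nonempty (Turing.TM2ComputableInPolyTime encodeTriple Computability.encodeBool P)

/-- The class `Σ₂ᴾ` of languages over the binary alphabet: `L` belongs to it if there are a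
polynomial-time predicate `P` and a polynomial `q` such that `x ∈ L` if and only if there is a
string `y` of length `q(|x|)` such that `P(x, y, z) = 1` for every string `z` of length `q(|x|)`. -/
def SigmaP2 : Set (Language Bool) :=
  {L | ∃ (P : List Bool × List Bool × List Bool → Bool) (q : Polynomial ℕ),
    IsPolyTimePredicate P ∧
    ∀ x : List Bool, x ∈ L ↔
      ∃ y : List Bool, y.length = q.eval x.length ∧
        ∀ z : List Bool, z.length = q.eval x.length → P (x, y, z) = true}

/-- `G` is `H`-free: `G` does not contain `H` as an induced subgraph. -/
def IsInducedFree {V W : Type} (H : SimpleGraph W) (G : SimpleGraph V) : Prop :=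
  ¬ H.IsIndContained G

/-- The number `⌈√(log₂ n)⌉`. -/
noncomputable def ceilSqrtLog (n : ℕ) : ℕ :=
  ⌈Real.sqrt (Real.logb 2 (n : ℝ))⌉₊

/-- `G` is a yes-instance: for `p = ⌈√(log₂ |V(G)|)⌉`, the graph `G` is `p`-colourable, or `G` is
`H`-free for some graph `H` with at most `p` vertices. -/
def IsYesInstance {V : Type} [Fintype V] (G : SimpleGraph V) : Prop :=
  G.Colorable (ceilSqrtLog (Fintype.card V)) ∨
    ∃ (W : Type) (_ : Fintype W) (H : SimpleGraph W),
      Fintype.card W ≤ ceilSqrtLog (Fintype.card V) ∧ IsInducedFree H G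

open Classical in
/-- The binary encoding of a graph on the vertices `0, …, n - 1`: the number `n` of vertices in
unary, closed by a `0`, and then the rows of the adjacency matrix, one after the other. -/
noncomputable def encodeGraph {n : ℕ} (G : SimpleGraph (Fin n)) : List Bool :=
  List.replicate n true ++ false ::
    (List.finRange n).flatMap fun i => (List.finRange n).map fun j => decide (G.Adj i j)

/-- The decision problem as a language: the encodings of the (nonempty) graphs that are
yes-instances. -/
def ColouringOrSubgraph : Language Bool :=
  {x | ∃ n : ℕ, 0 < n ∧ ∃ G : SimpleGraph (Fin n), IsYesInstance G ∧ x = encodeGraph G}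

/-! A certificate names a number k ≤ p in unary, together with either a colouring of G with k
colours or a graph H on k vertices. A colouring is checked directly. For H, the universally
quantified challenge is read as a relation between the vertices of H and those of G, and the
verifier accepts unless this relation is an induced embedding. One k serves both alternatives, since
k-colourability with k ≤ p implies p-colourability (`isYesInstance_iff`).

The bound k ≤ p must be checked without real arithmetic. It holds iff k = 0 or 2 ^ (k - 1) ^ 2 < n
(`le_ceilSqrtLog_iff`). The power is certified by a guessed table of pairs (e, m) in which every
entry is (0, 1) or doubles an entry of the previous row; induction on e then forces m = 2 ^ e
(`Second.eq_two_pow`).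

For polynomial time, the verifier is one fixed first-order formula whose variables range over
positions in the word x#y#z and whose atoms compare polynomial terms or read a symbol at a
polynomial position. Every such formula is compiled to a stack machine: a quantifier becomes a loop
over positions and a term a nest of loops over unary stacks, so the running time is polynomial for
each fixed formula (`isPolyTimePredicate`). It remains to see that the formula expresses the
intended check (`exists_of_verifies`, `verifies_of_isCount`), and that k and G do not depend on the
challenge (`mem_of_verifies`). -/

namespace Turing.TM2

/-! ### Embedding one stack machine in another -/

variable {K : Type} {Γ : K → Type} {Λ Λ' σ : Type}

/-- Relabel the jumps of a statement by `g` and continue with `q` instead of halting. -/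
def Stmt.extend (s : Stmt Γ Λ σ) (g : Λ → Λ') (q : Stmt Γ Λ' σ) : Stmt Γ Λ' σ :=
  match s with
  | .push k f s => .push k f (s.extend g q)
  | .peek k f s => .peek k f (s.extend g q)
  | .pop k f s => .pop k f (s.extend g q)
  | .load f s => .load f (s.extend g q)
  | .branch f s s' => .branch f (s.extend g q) (s'.extend g q)
  | .goto f => .goto fun v => g (f v)
  | .halt => q

variable [DecidableEq K]

/-- `StepsIn M n c c'`: the program `M` takes the configuration `c` to `c'` in `n` steps. -/
inductive StepsIn (M : Λ → Stmt Γ Λ σ) : ℕ → Cfg Γ Λ σ → Cfg Γ Λ σ → Prop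
  | refl (c) : StepsIn M 0 c c
  | head {n l v S c} : StepsIn M n (stepAux (M l) v S) c → StepsIn M (n + 1) ⟨some l, v, S⟩ c

theorem StepsIn.trans {M : Λ → Stmt Γ Λ σ} {m n : ℕ} {c c' c'' : Cfg Γ Λ σ}
    (h : StepsIn M m c c') (h' : StepsIn M n c' c'') : StepsIn M (m + n) c c'' := by
  induction h with
  | refl => simpa using h'
  | head _ ih => rw [Nat.add_right_comm]; exact (ih h').head

theorem StepsIn.iterate {M : Λ → Stmt Γ Λ σ} {n : ℕ} {c c' : Cfg Γ Λ σ} (h : StepsIn M n c c') :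
    (flip bind (step M))^[n] (some c) = some c' := by
  induction h with
  | refl => rfl
  | head _ ih => exact ih

theorem stepAux_extend (g : Λ → Λ') (q : Stmt Γ Λ' σ) (s : Stmt Γ Λ σ) (v : σ)
    (S : ∀ k, List (Γ k)) :
    stepAux (s.extend g q) v S =
      match stepAux s v S with
      | ⟨some l, v', S'⟩ => ⟨some (g l), v', S'⟩
      | ⟨none, v', S'⟩ => stepAux q v' S' := by
  induction s generalizing v S with
  | branch f s s' ih ih' => cases h : f v <;> simp [Stmt.extend, h, ih, ih']
  | goto | halt => rfl
  | _ => simp [Stmt.extend, *]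

/-- This is the gluing principle behind all program constructors. The continuation `q` replaces
`halt` within the same statement, so it is executed in the last step of the run and costs nothing
extra. -/
theorem StepsIn.extend {M : Λ → Stmt Γ Λ σ} {M' : Λ' → Stmt Γ Λ' σ} (g : Λ → Λ')
    (q : Stmt Γ Λ' σ) (hM : ∀ l, M' (g l) = (M l).extend g q) {n : ℕ} {l : Λ} {v v' : σ}
    {S S' : ∀ k, List (Γ k)} (h : StepsIn M n ⟨some l, v, S⟩ ⟨none, v', S'⟩) :
    StepsIn M' n ⟨some (g l), v, S⟩ (stepAux q v' S') := by
  generalize hc : (⟨some l, v, S⟩ : Cfg Γ Λ σ) = c at h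
  generalize hc' : (⟨none, v', S'⟩ : Cfg Γ Λ σ) = c' at h
  induction h generalizing l v S with
  | refl => simp [← hc'] at hc
  | @head n l₁ v₁ S₁ c₁ h₁ ih =>
    obtain ⟨rfl, rfl, rfl⟩ : l = l₁ ∧ v = v₁ ∧ S = S₁ := by simpa using hc
    refine .head ?_
    rw [hM, stepAux_extend]
    rcases hs : stepAux (M l) v S with ⟨_ | l', v₂, S₂⟩
    · rw [hs, ← hc'] at h₁
      cases h₁
      exact .refl _
    · exact ih hs.symm hc'

end Turing.TM2

/-! ### Structured programs over unary stacks -/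

namespace StackProgram

open Turing.TM2 Function

/-- The stacks of the machines below: the input word, a buffer and a counter, and three unary
stacks for each variable. -/
inductive Stack (V : Type)
  | input | buffer | counter
  | value (v : V) | covalue (v : V) | spare (v : V)
  deriving DecidableEq, Fintype

variable {V : Type}

/-- The alphabets of the stacks. -/
abbrev Stack.Sym : Stack V → Type
  | .input | .buffer => Option Bool
  | .counter => Bool
  | .value _ | .covalue _ | .spare _ => Unit

/-- The internal states: an auxiliary register, empty between statements, and a flag. -/
abbrev Reg : Type := Option (Option Bool) × Bool

/-- A finite program, thought of as a building block of larger ones. -/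
structure Fragment (V : Type) where
  Label : Type
  fin : Fintype Label
  start : Label
  code : Label → Stmt (Stack.Sym (V := V)) Label Reg

namespace Fragment

/-- A single statement. -/
def op (s : Stmt (Stack.Sym (V := V)) Unit Reg) : Fragment V :=
  ⟨Unit, inferInstance, (), fun _ => s⟩

/-- First `F`, then `F'`. -/
def seq (F F' : Fragment V) : Fragment V where
  Label := F.Label ⊕ F'.Label
  fin := letI := F.fin; letI := F'.fin; inferInstance
  start := .inl F.start
  code
    | .inl l => (F.code l).extend .inl (.goto fun _ => .inr F'.start)
    | .inr l => (F'.code l).extend .inr .halt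

/-- `F`, if the flag is set. -/
def whenFlag (F : Fragment V) : Fragment V where
  Label := Option F.Label
  fin := letI := F.fin; inferInstance
  start := none
  code
    | none => .branch Prod.snd (.goto fun _ => some F.start) .halt
    | some l => (F.code l).extend some .halt

/-- Repeat `F` as long as the stack `k` is nonempty and the flag satisfies `c`. -/
def loop (k : Stack V) (c : Bool → Bool) (F : Fragment V) : Fragment V where
  Label := Option F.Label
  fin := letI := F.fin; inferInstance
  start := none
  code
    | none => .peek k (fun r o => (o.map fun _ => none, r.2)) <|
        .branch (fun r => r.1.isSome && c r.2)
          (.load (fun r => (none, r.2)) (.goto fun _ => some F.start))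
          (.load (fun r => (none, r.2)) .halt)
    | some l => (F.code l).extend some (.goto fun _ => none)

variable [DecidableEq V] {F F' : Fragment V} {b b' b'' : Bool}
  {S S' S'' : ∀ k : Stack V, List k.Sym} {m n : ℕ}

/-- `F` takes the flag `b` and the stacks `S` to `b'` and `S'` within `n` steps. -/
def Runs (F : Fragment V) (b : Bool) (S : ∀ k : Stack V, List k.Sym) (b' : Bool)
    (S' : ∀ k : Stack V, List k.Sym) (n : ℕ) : Prop :=
  ∃ m ≤ n, StepsIn F.code m ⟨some F.start, (none, b), S⟩ ⟨none, (none, b'), S'⟩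

theorem Runs.mono (h : F.Runs b S b' S' m) (hmn : m ≤ n) : F.Runs b S b' S' n :=
  let ⟨i, hi, h⟩ := h
  ⟨i, hi.trans hmn, h⟩

theorem runs_op {s : Stmt (Stack.Sym (V := V)) Unit Reg}
    (h : stepAux s (none, b) S = ⟨none, (none, b'), S'⟩) : (op s).Runs b S b' S' 1 :=
  ⟨1, le_rfl, .head (h ▸ .refl _)⟩

theorem Runs.seq (h : F.Runs b S b' S' m) (h' : F'.Runs b' S' b'' S'' n) :
    (F.seq F').Runs b S b'' S'' (m + n) := by
  obtain ⟨i, hi, h⟩ := h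
  obtain ⟨j, hj, h'⟩ := h'
  exact ⟨i + j, by omega,
    (h.extend (M' := (F.seq F').code) .inl (.goto fun _ => .inr F'.start) fun _ => rfl).trans
    (h'.extend (M' := (F.seq F').code) .inr .halt fun _ => rfl)⟩

theorem Runs.whenFlag (h : F.Runs true S b' S' n) : F.whenFlag.Runs true S b' S' (n + 1) := by
  obtain ⟨i, hi, h⟩ := h
  exact ⟨i + 1, by omega, .head (h.extend (M' := F.whenFlag.code) some .halt fun _ => rfl)⟩

theorem runs_whenFlag_false : F.whenFlag.Runs false S false S 1 :=
  ⟨1, le_rfl, .head (.refl _)⟩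

variable {k : Stack V} {c : Bool → Bool}

theorem runs_loop_of_stop (h : S k = [] ∨ c b = false) : (F.loop k c).Runs b S b S 1 := by
  refine ⟨1, le_rfl, .head ?_⟩
  have : (((S k).head?.map fun _ => (none : Option Bool)).isSome && c b) = false := by
    rcases h with h | h <;> simp [h]
  simp only [loop, stepAux, this, cond_false]
  exact .refl _

theorem Runs.loop (hk : S k ≠ []) (hc : c b = true) (h : F.Runs b S b' S' m)
    (h' : (F.loop k c).Runs b' S' b'' S'' n) : (F.loop k c).Runs b S b'' S'' (m + n + 1) := by
  obtain ⟨i, hi, h⟩ := h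
  obtain ⟨j, hj, h'⟩ := h'
  refine ⟨i + j + 1, by omega, .head ?_⟩
  have : (((S k).head?.map fun _ => (none : Option Bool)).isSome && c b) = true := by
    obtain ⟨a, l, hl⟩ := List.exists_cons_of_ne_nil hk
    simp [hl, hc]
  simp only [Fragment.loop, stepAux, this, cond_true]
  exact (h.extend (M' := (F.loop k c).code) some (.goto fun _ => none) fun _ => rfl).trans h'

end Fragment

/-- The contents of the input, buffer and counter stacks. -/
abbrev Core : Type := List (Option Bool) × List (Option Bool) × List Bool

/-- The stacks with the given contents, numbers being written in unary. -/
def contents (c : Core) (f g h : V → ℕ) : ∀ k : Stack V, List k.Sym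
  | .input => c.1
  | .buffer => c.2.1
  | .counter => c.2.2
  | .value v => List.replicate (f v) ()
  | .covalue v => List.replicate (g v) ()
  | .spare v => List.replicate (h v) ()

section contents

variable [DecidableEq V] (c : Core) (f g h : V → ℕ) (v : V) (n : ℕ)

@[simp] theorem update_input (l : List (Option Bool)) :
    update (contents c f g h) .input l = contents (l, c.2) f g h := by
  funext k; cases k <;> simp [contents, update]

@[simp] theorem update_buffer (l : List (Option Bool)) :
    update (contents c f g h) .buffer l = contents (c.1, l, c.2.2) f g h := by
  funext k; cases k <;> simp [contents, update]

@[simp] theorem update_counter (l : List Bool) :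
    update (contents c f g h) .counter l = contents (c.1, c.2.1, l) f g h := by
  funext k; cases k <;> simp [contents, update]

@[simp] theorem update_value (l : List Unit) :
    update (contents c f g h) (.value v) l = contents c (update f v l.length) g h := by
  funext k
  cases k with
  | value u => by_cases e : u = v <;> [subst e; skip] <;> simp [contents, *, List.eq_replicate_iff]
  | _ => simp [contents, update]

@[simp] theorem update_covalue (l : List Unit) :
    update (contents c f g h) (.covalue v) l = contents c f (update g v l.length) h := by
  funext k
  cases k with
  | covalue u => by_cases e : u = v <;> [subst e; skip] <;> simp [contents, *, List.eq_replicate_iff]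
  | _ => simp [contents, update]

@[simp] theorem update_spare (l : List Unit) :
    update (contents c f g h) (.spare v) l = contents c f g (update h v l.length) := by
  funext k
  cases k with
  | spare u => by_cases e : u = v <;> [subst e; skip] <;> simp [contents, *, List.eq_replicate_iff]
  | _ => simp [contents, update]

end contents

end StackProgram

/-! ### Iterating a program as often as a polynomial says -/

namespace StackProgram

open Turing.TM2 Function Fragment

variable {V : Type}

/-- Polynomials with nonnegative coefficients in the variables `V`. -/
inductive Term (V : Type)
  | one
  | add (s t : Term V)
  | mul (v : V) (t : Term V)

namespace Term

/-- The value of a term. -/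
def eval (f : V → ℕ) : Term V → ℕ
  | one => 1
  | add s t => s.eval f + t.eval f
  | mul v t => f v * t.eval f

/-- The variables that occur in a term. -/
def vars : Term V → List V
  | one => []
  | add s t => s.vars ++ t.vars
  | mul v t => v :: t.vars

/-- The monomials of the term are squarefree. -/
def Squarefree : Term V → Prop
  | one => True
  | add s t => s.Squarefree ∧ t.Squarefree
  | mul v t => v ∉ t.vars ∧ t.Squarefree

theorem eval_congr {f g : V → ℕ} {t : Term V} (h : ∀ v ∈ t.vars, f v = g v) :
    t.eval f = t.eval g := by
  induction t with
  | one => rfl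
  | add s t ihs iht =>
    simp only [vars, List.mem_append] at h
    simp only [eval, ihs fun v hv => h v (.inl hv), iht fun v hv => h v (.inr hv)]
  | mul v t ih =>
    simp only [vars, List.mem_cons] at h
    simp only [eval, h v (.inl rfl), ih fun v hv => h v (.inr hv)]

/-- Repeat the fragment `F` as often as the value of the term says. -/
def times (F : Fragment V) : Term V → Fragment V
  | one => F
  | add s t => (s.times F).seq (t.times F)
  | mul v t =>
    (loop (.value v) (fun _ => true)
      ((op (.pop (.value v) (fun r _ => r) (.push (.spare v) (fun _ => ()) .halt))).seq
        (t.times F))).seq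
    (loop (.spare v) (fun _ => true)
      (op (.pop (.spare v) (fun r _ => r) (.push (.value v) (fun _ => ()) .halt))))

variable [DecidableEq V]

theorem runs_restore_spare (v : V) (b : Bool) (c : Core) (g : V → ℕ) (n : ℕ) (f h : V → ℕ)
    (hn : h v = n) :
    (loop (.spare v) (fun _ => true)
      (op (.pop (.spare v) (fun r _ => r) (.push (.value v) (fun _ => ()) .halt)))).Runs
      b (contents c f g h) b (contents c (update f v (f v + n)) g (update h v 0)) (n * 2 + 1) := by
  induction n generalizing f h with
  | zero =>
    have e : update h v 0 = h := by rw [← hn, update_eq_self]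
    simpa [e] using runs_loop_of_stop (.inl (by simp [contents, hn]))
  | succ n ih =>
    have h₁ := ih (update f v (f v + 1)) (update h v n) (by simp)
    refine (Runs.loop (b' := b) (by simp [contents, hn]) rfl (runs_op
      (S' := contents c (update f v (f v + 1)) g (update h v n)) ?_) ?_).mono
        (show 1 + (n * 2 + 1) + 1 ≤ _ by omega)
    · simp [contents, hn]
    · simpa [Nat.add_assoc, Nat.add_comm 1 n] using h₁

/-- A factor `v` is handled by draining its value stack into its spare stack, one mark per round,
and refilling it afterwards. During the inner rounds the value stack is altered, so the rest of the
monomial must not mention `v`: this is the role of `Squarefree`. The polynomial is chosen before the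
stack contents. -/
theorem runs_times {F : Fragment V} {b : Bool} {φ : Core → Core}
    (hF : ∀ c f g h, F.Runs b (contents c f g h) b (contents (φ c) f g h) 1) (t : Term V)
    (ht : t.Squarefree) :
    ∃ p : Polynomial ℕ, ∀ (N : ℕ) (c : Core) (f g h : V → ℕ), (∀ v, f v ≤ N) →
      (∀ v ∈ t.vars, h v = 0) →
      (t.times F).Runs b (contents c f g h) b (contents (φ^[t.eval f] c) f g h) (p.eval N) := by
  induction t with
  | one => exact ⟨1, fun N c f g h _ _ => by simpa [times, eval] using hF c f g h⟩
  | add s t ihs iht =>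
    obtain ⟨p, hp⟩ := ihs ht.1
    obtain ⟨q, hq⟩ := iht ht.2
    refine ⟨p + q, fun N c f g h hf hh => ?_⟩
    simp only [vars, List.mem_append] at hh
    rw [eval, Nat.add_comm (s.eval f), iterate_add_apply, Polynomial.eval_add]
    exact (hp N c f g h hf fun v hv => hh v (.inl hv)).seq
      (hq N _ f g h hf fun v hv => hh v (.inr hv))
  | mul v t ih =>
    obtain ⟨p, hp⟩ := ih ht.2
    refine ⟨Polynomial.X * (p + 2) + 1 + (Polynomial.X * 2 + 1), fun N c f g h hf hh => ?_⟩
    simp only [vars, List.mem_cons, forall_eq_or_imp] at hh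
    have key : ∀ (n : ℕ) (c : Core) (f h : V → ℕ), (∀ v, f v ≤ N) → (∀ v ∈ t.vars, h v = 0) →
        f v = n →
        (loop (.value v) (fun _ => true)
          ((op (.pop (.value v) (fun r _ => r) (.push (.spare v) (fun _ => ()) .halt))).seq
            (t.times F))).Runs b (contents c f g h) b
          (contents (φ^[n * t.eval f] c) (update f v 0) g (update h v (h v + n)))
          (n * (p.eval N + 2) + 1) := by
      intro n
      induction n with
      | zero =>
        intro c f h _ _ hn
        have e : update f v 0 = f := by rw [← hn, update_eq_self]
        simpa [e] using runs_loop_of_stop (.inl (by simp [contents, hn]))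
      | succ n ihn =>
        intro c f h hf hh hn
        have hf' : ∀ u, update f v n u ≤ N := fun u => by
          by_cases e : u = v
          · subst e; have := hf u; simp; omega
          · simpa [e] using hf u
        have hh' : ∀ u ∈ t.vars, update h v (h v + 1) u = 0 := fun u hu => by
          rw [update_of_ne (by rintro rfl; exact ht.1 hu)]
          exact hh u hu
        -- The inner term does not contain `v`, so every round repeats the body equally often.
        have et : t.eval (update f v n) = t.eval f :=
          eval_congr fun u hu => update_of_ne (by rintro rfl; exact ht.1 hu) _ _
        have h₁ := hp N c _ g _ hf' hh'
        have h₂ := ihn (φ^[t.eval f] c) _ _ hf' hh' (by simp)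
        rw [et] at h₁ h₂
        rw [← iterate_add_apply] at h₂
        refine (Runs.loop (b' := b) (by simp [contents, hn]) rfl ((runs_op
          (S' := contents c (update f v n) g (update h v (h v + 1))) ?_).seq h₁) ?_).mono
            (show 1 + p.eval N + (n * (p.eval N + 2) + 1) + 1 ≤ _ by linarith)
        · simp [contents, hn]
        · simpa [Nat.add_mul, Nat.add_assoc, Nat.add_comm 1 n] using h₂
    have h₁ := key (f v) c f h hf hh.2 rfl
    have h₂ := runs_restore_spare v b (φ^[f v * t.eval f] c) g (f v) (update f v 0)
      (update h v (h v + f v)) (by simp [hh.1])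
    have e : update h v 0 = h := by rw [← hh.1, update_eq_self]
    simp only [update_self, update_idem, zero_add, update_eq_self, e] at h₂
    refine (h₁.seq h₂).mono ?_
    have := Nat.mul_le_mul_right (p.eval N + 2) (hf v)
    have := hf v
    simp
    omega

end Term

/-! ### First-order formulas on words and their evaluation -/

/-- First-order formulas about a word: the variables range over the positions in the word. -/
inductive Formula (V : Type)
  | le (s t : Term V)
  | symbol (t : Term V) (a : Option Bool)
  | not (φ : Formula V)
  | and (φ ψ : Formula V)
  | all (v : V) (φ : Formula V)

namespace Formula

/-- The bound variables of a formula. -/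
def bound : Formula V → List V
  | le _ _ | symbol _ _ => []
  | not φ => φ.bound
  | and φ ψ => φ.bound ++ ψ.bound
  | all v φ => v :: φ.bound

/-- Monomials are squarefree, and no variable is bound twice on a branch of the formula. -/
def WellFormed : Formula V → Prop
  | le s t => s.Squarefree ∧ t.Squarefree
  | symbol t _ => t.Squarefree
  | not φ => φ.WellFormed
  | and φ ψ => φ.WellFormed ∧ ψ.WellFormed
  | all v φ => v ∉ φ.bound ∧ φ.WellFormed

variable [DecidableEq V]

/-- The formula is true in the word `w` for the values `f` of the variables. -/
def Holds (w : List (Option Bool)) (f : V → ℕ) : Formula V → Prop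
  | le s t => s.eval f ≤ t.eval f
  | symbol t a => w[t.eval f]? = some a
  | not φ => ¬ φ.Holds w f
  | and φ ψ => φ.Holds w f ∧ ψ.Holds w f
  | all v φ => ∀ i < w.length, φ.Holds w (update f v i)

/-- Move the top symbol of the input to the buffer. -/
def shift : Fragment V :=
  op (.pop .input (fun r o => (o, r.2)) (.branch (fun r => r.1.isSome)
    (.push .buffer (fun r => r.1.getD none) (.load (fun r => (none, r.2)) .halt))
    (.load (fun r => (none, r.2)) .halt)))

/-- Move the buffer back to the input. -/
def unshift : Fragment V :=
  loop .buffer (fun _ => true)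
    (op (.pop .buffer (fun r o => (o, r.2)) (.push .input (fun r => r.1.getD none)
      (.load (fun r => (none, r.2)) .halt))))

/-- Evaluate a formula. -/
def eval : Formula V → Fragment V
  | le s t =>
    (s.times (op (.push .counter (fun _ => true) .halt))).seq <|
    (t.times (op (.pop .counter (fun r _ => r) .halt))).seq <|
    (op (.peek .counter (fun r o => (r.1, o.isNone)) .halt)).seq <|
    loop .counter (fun _ => true) (op (.pop .counter (fun r _ => r) .halt))
  | symbol t a =>
    (t.times shift).seq <| (op (.peek .input (fun r o => (r.1, decide (o = some a))) .halt)).seq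
    unshift
  | not φ => φ.eval.seq (op (.load (fun r => (r.1, !r.2)) .halt))
  | and φ ψ => φ.eval.seq ψ.eval.whenFlag
  | all v φ =>
    (op (.load (fun r => (r.1, true)) .halt)).seq <|
    (loop (.covalue v) id (φ.eval.seq (whenFlag
      (op (.pop (.covalue v) (fun r _ => r) (.push (.value v) (fun _ => ()) .halt)))))).seq <|
    loop (.value v) (fun _ => true)
      (op (.pop (.value v) (fun r _ => r) (.push (.covalue v) (fun _ => ()) .halt)))

theorem runs_shift (b : Bool) (c : Core) (f g h : V → ℕ) :
    shift.Runs b (contents c f g h) b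
      (contents (c.1.tail, c.1.head?.toList ++ c.2.1, c.2.2) f g h) 1 := by
  apply runs_op
  obtain ⟨_ | ⟨a, l⟩, m, n⟩ := c <;> simp [contents]

theorem iterate_shift (n : ℕ) (c : Core) :
    (fun c : Core => ((c.1.tail, c.1.head?.toList ++ c.2.1, c.2.2) : Core))^[n] c =
      (c.1.drop n, (c.1.take n).reverse ++ c.2.1, c.2.2) := by
  induction n generalizing c with
  | zero => simp
  | succ n ih => obtain ⟨_ | ⟨a, l⟩, m, k⟩ := c <;> simp [iterate_succ_apply, ih]

theorem runs_unshift (b : Bool) (f g h : V → ℕ) (l m : List (Option Bool)) (n : List Bool) :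
    unshift.Runs b (contents (l, m, n) f g h) b
      (contents (m.reverse ++ l, [], n) f g h) (m.length * 2 + 1) := by
  induction m generalizing l with
  | nil => exact runs_loop_of_stop (.inl rfl)
  | cons a m ih =>
    refine (Runs.loop (b' := b) (by simp [contents]) rfl (runs_op
      (S' := contents (a :: l, m, n) f g h) ?_) ?_).mono (show 1 + (m.length * 2 + 1) + 1 ≤ _ by simp; omega)
    · simp [contents]
    · simpa [unshift] using ih (a :: l)

theorem runs_clear_counter (b : Bool) (f g h : V → ℕ) (l m : List (Option Bool)) (n : List Bool) :
    (loop .counter (fun _ => true) (op (.pop .counter (fun r _ => r) .halt))).Runs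
      b (contents (l, m, n) f g h) b (contents (l, m, []) f g h) (n.length * 2 + 1) := by
  induction n with
  | nil => exact runs_loop_of_stop (.inl rfl)
  | cons a n ih =>
    exact (Runs.loop (b' := b) (by simp [contents]) rfl (runs_op (S' := contents (l, m, n) f g h)
      (by simp [contents])) ih).mono (show 1 + (n.length * 2 + 1) + 1 ≤ _ by simp; omega)

theorem runs_restore_value (v : V) (b : Bool) (c : Core) (n : ℕ) (f g h : V → ℕ)
    (hn : f v = n) :
    (loop (.value v) (fun _ => true)
      (op (.pop (.value v) (fun r _ => r) (.push (.covalue v) (fun _ => ()) .halt)))).Runs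
      b (contents c f g h) b (contents c (update f v 0) (update g v (g v + n)) h) (n * 2 + 1) := by
  induction n generalizing f g with
  | zero =>
    have e : update f v 0 = f := by rw [← hn, update_eq_self]
    simpa [e] using runs_loop_of_stop (.inl (by simp [contents, hn]))
  | succ n ih =>
    have h₁ := ih (update f v n) (update g v (g v + 1)) (by simp)
    refine (Runs.loop (b' := b) (by simp [contents, hn]) rfl (runs_op
      (S' := contents c (update f v n) (update g v (g v + 1)) h) ?_) ?_).mono
        (show 1 + (n * 2 + 1) + 1 ≤ _ by omega)
    · simp [contents, hn]
    · simpa [Nat.add_assoc, Nat.add_comm 1 n] using h₁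

omit [DecidableEq V] in
theorem _root_.StackProgram.Term.exists_eval_le (t : Term V) :
    ∃ p : Polynomial ℕ, ∀ (N : ℕ) (f : V → ℕ), (∀ v, f v ≤ N) → t.eval f ≤ p.eval N := by
  induction t with
  | one => exact ⟨1, fun N f _ => by simp [Term.eval]⟩
  | add s t ihs iht =>
    obtain ⟨p, hp⟩ := ihs
    obtain ⟨q, hq⟩ := iht
    exact ⟨p + q, fun N f h => by simpa [Term.eval] using add_le_add (hp N f h) (hq N f h)⟩
  | mul v t ih =>
    obtain ⟨p, hp⟩ := ih
    exact ⟨.X * p, fun N f h => by simpa [Term.eval] using Nat.mul_le_mul (h v) (hp N f h)⟩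

-- The invariant is that the value and covalue stacks of each variable together hold as many marks
-- as the word has symbols, and that evaluation restores all stacks and changes only the flag. For
-- `le`, popping an empty counter does nothing, so the counter ends at the truncated difference,
-- which is empty iff the inequality holds. For `all`, marks move from covalue to value until a
-- counterexample appears or the covalue stack is empty; the loop starts at 0 because bound
-- variables have empty value stacks, which is why no variable may be bound again in its own scope.
open Classical in
theorem exists_runs_eval (φ : Formula V) (hφ : φ.WellFormed) :
    ∃ p : Polynomial ℕ, ∀ (w : List (Option Bool)) (f : V → ℕ) (b : Bool),
      (∀ v, f v ≤ w.length) → (∀ v ∈ φ.bound, f v = 0) →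
      φ.eval.Runs b (contents (w, [], []) f (fun v => w.length - f v) 0)
        (decide (φ.Holds w f)) (contents (w, [], []) f (fun v => w.length - f v) 0)
        (p.eval w.length) := by
  induction φ with
  | le s t =>
    have hpush (b : Bool) (c : Core) (f g h : V → ℕ) :
        (op (.push .counter (fun _ => true) .halt)).Runs b (contents c f g h) b
          (contents (c.1, c.2.1, true :: c.2.2) f g h) 1 :=
      runs_op (by simp [contents])
    have hpop (b : Bool) (c : Core) (f g h : V → ℕ) :
        (op (.pop .counter (fun r _ => r) .halt)).Runs b (contents c f g h) b
          (contents (c.1, c.2.1, c.2.2.tail) f g h) 1 :=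
      runs_op (by simp [contents])
    have ipush (n : ℕ) (c : Core) :
        (fun c : Core => ((c.1, c.2.1, true :: c.2.2) : Core))^[n] c =
          (c.1, c.2.1, List.replicate n true ++ c.2.2) := by
      induction n generalizing c with
      | zero => rfl
      | succ n ih => simp [iterate_succ_apply, ih, List.replicate_succ']
    have ipop (n : ℕ) (c : Core) :
        (fun c : Core => ((c.1, c.2.1, c.2.2.tail) : Core))^[n] c =
          (c.1, c.2.1, c.2.2.drop n) := by
      induction n generalizing c with
      | zero => rfl
      | succ n ih => simp [iterate_succ_apply, ih]
    -- The flag is fixed while a term is iterated, so the time bound may depend on it; adding the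
    -- bounds for both flags removes the dependence.
    choose p hp using fun b => Term.runs_times (b := b) (hpush b) s hφ.1
    choose q hq using fun b => Term.runs_times (b := b) (hpop b) t hφ.2
    obtain ⟨r, hr⟩ := s.exists_eval_le
    refine ⟨p true + p false + (q true + q false + (1 + (r * 2 + 1))), fun w f b hf _ => ?_⟩
    have h₁ := hp b w.length (w, [], []) f (fun v => w.length - f v) 0 hf fun _ _ => rfl
    have h₂ := hq b w.length (w, [], List.replicate (s.eval f) true) f
      (fun v => w.length - f v) 0 hf fun _ _ => rfl
    simp only [ipush, List.append_nil] at h₁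
    refine ((h₁.seq (h₂.seq ((runs_op ?_).seq (runs_clear_counter _ f _ 0 w []
      (List.replicate (s.eval f - t.eval f) true))))).mono ?_)
    · simp only [stepAux, ipop]
      rcases h : s.eval f - t.eval f with _ | n
      · simp [contents, Holds, h, Nat.sub_eq_zero_iff_le.1 h]
      · simp [contents, Holds, h, List.replicate_succ, show ¬ s.eval f ≤ t.eval f by omega]
    · have := hr w.length f hf
      cases b <;> simp <;> omega
  | symbol t a =>
    choose p hp using fun b => Term.runs_times (b := b) (runs_shift b) t hφ
    refine ⟨p true + p false + (1 + (.X * 2 + 1)), fun w f b hf _ => ?_⟩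
    have h₁ := hp b w.length (w, [], []) f (fun v => w.length - f v) 0 hf fun _ _ => rfl
    rw [iterate_shift] at h₁
    have h₂ := runs_unshift (decide ((symbol t a).Holds w f)) f (fun v => w.length - f v) 0
      (w.drop (t.eval f)) (w.take (t.eval f)).reverse []
    simp only [List.reverse_reverse, List.take_append_drop] at h₂
    simp only [List.append_nil] at h₁
    refine (h₁.seq ((runs_op ?_).seq h₂)).mono ?_
    · simp only [stepAux, contents, Holds, List.head?_drop]
      congr
    · cases b <;> simp <;> omega
  | not φ ih =>
    obtain ⟨p, hp⟩ := ih hφ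
    refine ⟨p + 1, fun w f b hf hb => ?_⟩
    simpa [eval] using (hp w f b hf hb).seq (runs_op (b' := decide ((not φ).Holds w f))
      (by by_cases h : φ.Holds w f <;> simp [Holds, h]))
  | and φ ψ ihφ ihψ =>
    obtain ⟨p, hp⟩ := ihφ hφ.1
    obtain ⟨q, hq⟩ := ihψ hφ.2
    refine ⟨p + (q + 1), fun w f b hf hb => ?_⟩
    simp only [bound, List.mem_append] at hb
    have h₁ := hp w f b hf fun v hv => hb v (.inl hv)
    have h₂ := hq w f true hf fun v hv => hb v (.inr hv)
    rw [Polynomial.eval_add]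
    refine h₁.seq ?_
    by_cases h : φ.Holds w f
    · simpa [h, Holds] using h₂.whenFlag
    · simpa [h, Holds] using runs_whenFlag_false.mono (Nat.le_add_left _ _)
  | all v φ ih =>
    obtain ⟨p, hp⟩ := ih hφ.2
    refine ⟨1 + (.X * (p + 3) + p + 3 + (.X * 2 + 1)), fun w f b hf hb => ?_⟩
    simp only [bound, List.mem_cons, forall_eq_or_imp] at hb
    -- `R i` is the part of the universal statement still open when the loop has reached `i`. The
    -- final position `j` is either the first counterexample or the length of the word.
    obtain ⟨R, hR⟩ : ∃ R : ℕ → Prop,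
        ∀ i, R i ↔ ∀ j < w.length, i ≤ j → φ.Holds w (update f v j) := ⟨_, fun _ => Iff.rfl⟩
    have key : ∀ (n i : ℕ), i + n = w.length → ∃ j ≤ w.length,
        (loop (.covalue v) id (φ.eval.seq (whenFlag (op (.pop (.covalue v) (fun r _ => r)
          (.push (.value v) (fun _ => ()) .halt)))))).Runs true
          (contents (w, [], []) (update f v i) (fun u => w.length - update f v i u) 0)
          (decide (R i))
          (contents (w, [], []) (update f v j) (fun u => w.length - update f v j u) 0)
          (n * (p.eval w.length + 3) + p.eval w.length + 3) := by
      intro n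
      induction n with
      | zero =>
        intro i hi
        refine ⟨i, by omega, ?_⟩
        have : R i := (hR i).2 fun j _ _ => by omega
        simp only [this, decide_true]
        exact (runs_loop_of_stop (.inl (by simp [contents, ← hi]))).mono (by omega)
      | succ n ihn =>
        intro i hi
        have hf' : ∀ u, update f v i u ≤ w.length := fun u => by
          by_cases e : u = v
          · subst e; simp; omega
          · simpa [e] using hf u
        have hb' : ∀ u ∈ φ.bound, update f v i u = 0 := fun u hu => by
          rw [update_of_ne (by rintro rfl; exact hφ.1 hu)]
          exact hb.2 u hu
        have h₁ := hp w _ true hf' hb'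
        have hne : contents (w, [], []) (update f v i) (fun u => w.length - update f v i u) 0
            (.covalue v) ≠ [] := by
          simp [contents]; omega
        by_cases h : φ.Holds w (update f v i)
        · obtain ⟨j, hj, h₂⟩ := ihn (i + 1) (by omega)
          have e : R i ↔ R (i + 1) := by
            rw [hR, hR]
            refine ⟨fun H j hj hij => H j hj (by omega), fun H j hj hij => ?_⟩
            rcases hij.eq_or_lt with rfl | hij
            · exact h
            · exact H j hj hij
          simp only [h, decide_true] at h₁
          simp only [e]
          refine ⟨j, hj, (Runs.loop hne rfl (h₁.seq (Runs.whenFlag (runs_op ?_))) h₂).mono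
            (by linarith)⟩
          have e' : update (fun u => w.length - update f v i u) v (w.length - i - 1) =
              fun u => w.length - update f v (i + 1) u := by
            funext u
            by_cases hu : u = v
            · subst hu; simp; omega
            · simp [hu]
          simp [contents, e']
        · have e : ¬ R i := fun H => h ((hR i).1 H i (by omega) le_rfl)
          simp only [h, decide_false] at h₁
          rw [decide_eq_false e]
          refine ⟨i, by omega, (Runs.loop hne rfl (h₁.seq runs_whenFlag_false)
            (runs_loop_of_stop (.inr rfl))).mono
              (by linarith [Nat.zero_le (n * (p.eval w.length + 3))])⟩
    obtain ⟨j, hj, h₁⟩ := key w.length 0 (by simp)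
    have e : update f v 0 = f := by rw [← hb.1, update_eq_self]
    simp only [e] at h₁
    rw [show decide (R 0) = decide ((all v φ).Holds w f) by
      rw [decide_eq_decide, hR]; simp [Holds]] at h₁
    have h₂ := runs_restore_value v (decide ((all v φ).Holds w f)) (w, [], []) j (update f v j)
      (fun u => w.length - update f v j u) 0 (by simp)
    have e' : update (fun u => w.length - update f v j u) v (w.length - j + j) =
        fun u => w.length - f u := by
      funext u
      by_cases hu : u = v
      · subst hu; simp [hb.1]; omega
      · simp [hu]
    simp only [update_self, update_idem, e, e'] at h₂
    refine ((runs_op (by simp)).seq (h₁.seq h₂)).mono ?_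
    simp
    omega

end Formula

end StackProgram

/-! ### The complete machine deciding a formula -/

namespace StackProgram

open Turing Turing.TM2 Function Fragment

variable {V : Type} [DecidableEq V]

namespace Formula

/-- Push a mark on the covalue stacks of all variables in the list, then continue with `s`. -/
def pushAll {Λ : Type} (s : Stmt (Stack.Sym (V := V)) Λ Reg) :
    List V → Stmt (Stack.Sym (V := V)) Λ Reg
  | [] => s
  | v :: l => .push (.covalue v) (fun _ => ()) (pushAll s l)

/-- Pop the covalue stacks of all variables in the list, then continue with `s`. -/
def popAll {Λ : Type} (s : Stmt (Stack.Sym (V := V)) Λ Reg) :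
    List V → Stmt (Stack.Sym (V := V)) Λ Reg
  | [] => s
  | v :: l => .pop (.covalue v) (fun r _ => r) (popAll s l)

theorem stepAux_pushAll {Λ : Type} (s : Stmt (Stack.Sym (V := V)) Λ Reg) (l : List V) (r : Reg)
    (c : Core) (f g h : V → ℕ) :
    stepAux (pushAll s l) r (contents c f g h) =
      stepAux s r (contents c f (fun v => g v + l.count v) h) := by
  induction l generalizing g with
  | nil => rfl
  | cons u l ih =>
    have : (fun v => update g u (g u + 1) v + l.count v) = fun v => g v + (u :: l).count v := by
      funext v
      by_cases e : v = u
      · subst e; simp; omega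
      · simp [e, Ne.symm e]
    simp [pushAll, ← this, ← ih, contents]

theorem stepAux_popAll {Λ : Type} (s : Stmt (Stack.Sym (V := V)) Λ Reg) (l : List V) (r : Reg)
    (c : Core) (f g h : V → ℕ) :
    stepAux (popAll s l) r (contents c f g h) =
      stepAux s r (contents c f (fun v => g v - l.count v) h) := by
  induction l generalizing g with
  | nil => rfl
  | cons u l ih =>
    have : (fun v => update g u (g u - 1) v - l.count v) = fun v => g v - (u :: l).count v := by
      funext v
      by_cases e : v = u
      · subst e; simp; omega
      · simp [e, Ne.symm e]
    simp [popAll, ← this, ← ih, contents]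

variable [Fintype V]

theorem count_univ (v : V) : (Finset.univ : Finset V).toList.count v = 1 :=
  List.count_eq_one_of_mem (Finset.nodup_toList _) (by simp)

/-- Fill the covalue stacks with as many marks as there are symbols in the input. -/
noncomputable def fill : Fragment V :=
  (loop .input (fun _ => true)
    (op (.pop .input (fun r o => (o, r.2)) (.push .buffer (fun r => r.1.getD none)
      (.load (fun r => (none, r.2)) (pushAll .halt Finset.univ.toList)))))).seq unshift

/-- Clear the input and the covalue stacks. -/
noncomputable def clear : Fragment V :=
  loop .input (fun _ => true)
    (op (.pop .input (fun r _ => r) (popAll .halt Finset.univ.toList)))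

theorem runs_fill (b : Bool) (w : List (Option Bool)) :
    (fill (V := V)).Runs b (contents (w, [], []) 0 0 0) b
      (contents (w, [], []) 0 (fun _ => w.length) 0) (w.length * 2 + 1 + (w.length * 2 + 1)) := by
  have key (l m : List (Option Bool)) (n : ℕ) :
      (loop .input (fun _ => true)
        (op (.pop .input (fun r o => (o, r.2)) (.push .buffer (fun r => r.1.getD none)
          (.load (fun r => (none, r.2)) (pushAll .halt Finset.univ.toList)))))).Runs (V := V)
        b (contents (l, m, []) 0 (fun _ => n) 0) b
        (contents ([], l.reverse ++ m, []) 0 (fun _ => n + l.length) 0) (l.length * 2 + 1) := by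
    induction l generalizing m n with
    | nil => exact runs_loop_of_stop (.inl rfl)
    | cons a l ih =>
      have h₁ := ih (a :: m) (n + 1)
      refine (Runs.loop (b' := b) (by simp [contents]) rfl (runs_op
        (S' := contents (l, a :: m, []) 0 (fun _ => n + 1) 0) ?_) ?_).mono
          (show 1 + (l.length * 2 + 1) + 1 ≤ _ by simp; omega)
      · simp [contents, stepAux_pushAll, count_univ]
      · simpa [Nat.add_assoc, Nat.add_comm 1] using h₁
  have h₁ := key w [] 0
  have h₂ := runs_unshift (V := V) b 0 (fun _ => w.length) 0 [] w.reverse []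
  simp only [List.append_nil, List.reverse_reverse, List.length_reverse, zero_add] at h₁ h₂
  exact h₁.seq h₂

theorem runs_clear (b : Bool) (w : List (Option Bool)) :
    (clear (V := V)).Runs b (contents (w, [], []) 0 (fun _ => w.length) 0) b
      (contents ([], [], []) 0 0 0) (w.length * 2 + 1) := by
  induction w with
  | nil => exact runs_loop_of_stop (.inl rfl)
  | cons a w ih =>
    exact (Runs.loop (b' := b) (by simp [contents]) rfl (runs_op
      (S' := contents (w, [], []) 0 (fun _ => w.length) 0)
        (by simp [contents, stepAux_popAll, count_univ])) ih).mono
        (show 1 + (w.length * 2 + 1) + 1 ≤ _ by simp; omega)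

/-- The program that replaces a word by the truth value of the formula. -/
noncomputable def decide (φ : Formula V) : Fragment V :=
  fill.seq (φ.eval.seq (clear.seq (op (.push .counter (fun r => r.2)
    (.load (fun _ => (none, false)) .halt)))))

-- The initial machine has only its input stack filled, and a halting configuration must have only
-- its output stack filled and the initial register. Hence the evaluation is framed by `fill`, which
-- sets up the covalue stacks, and `clear`, which empties them and the input; the flag is reset
-- after being output.
open Classical in
theorem exists_runs_decide (φ : Formula V) (hφ : φ.WellFormed) :
    ∃ p : Polynomial ℕ, ∀ w : List (Option Bool),
      φ.decide.Runs false (contents (w, [], []) 0 0 0)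
        false (contents ([], [], [Decidable.decide (φ.Holds w 0)]) 0 0 0) (p.eval w.length) := by
  obtain ⟨p, hp⟩ := φ.exists_runs_eval hφ
  refine ⟨.X * 2 + 1 + (.X * 2 + 1) + (p + (.X * 2 + 1 + 1)), fun w => ?_⟩
  have h₁ := runs_fill (V := V) false w
  have h₂ := hp w 0 false (by simp) (by simp)
  have h₃ := runs_clear (V := V) (Decidable.decide (φ.Holds w 0)) w
  simp only [Pi.zero_apply, tsub_zero] at h₂
  refine (h₁.seq (h₂.seq (h₃.seq (runs_op ?_)))).mono ?_
  · simp [contents]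
  · simp

/-- The Turing machine that decides a formula. -/
noncomputable def machine (φ : Formula V) : FinTM2 :=
  letI := φ.decide.fin
  { K := Stack V
    k₀ := .input
    k₁ := .counter
    Γ := Stack.Sym
    Λ := φ.decide.Label
    main := φ.decide.start
    σ := Reg
    initialState := (none, false)
    Γk₀Fin := inferInstanceAs (Fintype (Option Bool))
    m := φ.decide.code }

open Classical in
theorem isPolyTimePredicate (φ : Formula V) (hφ : φ.WellFormed) :
    IsPolyTimePredicate fun w => Decidable.decide (φ.Holds (encodeTriple w) 0) := by
  obtain ⟨p, hp⟩ := φ.exists_runs_decide hφ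
  choose n hn h using fun w => hp w
  refine ⟨⟨⟨φ.machine, .refl _, .refl _⟩, p, fun a => ⟨⟨n (encodeTriple a), ?_⟩, ?_⟩⟩⟩
  · have hi (w : List (Option Bool)) : initList φ.machine (List.map id w) =
        ⟨some φ.decide.start, (none, false), contents (w, [], []) 0 0 0⟩ := by
      change Cfg.mk _ _ _ = Cfg.mk _ _ _
      congr 1
      funext k
      cases k with
      | input => exact List.map_id w
      | _ => rfl
    have ho (b : Bool) : haltList φ.machine [b] =
        ⟨none, (none, false), contents ([], [], [b]) 0 0 0⟩ := by
      change Cfg.mk _ _ _ = Cfg.mk _ _ _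
      congr 1
      funext k
      cases k <;> rfl
    exact (congrArg (fun c => (flip bind (step φ.decide.code))^[_] (some c)) (hi _)).trans
      ((h (encodeTriple a)).iterate.trans (congrArg some (ho _).symm))
  · simpa using hn (encodeTriple a)

end Formula

end StackProgram

/-! ### Derived terms and connectives -/

namespace StackProgram

open Function

namespace Term

variable {V : Type}

/-- A variable as a term. -/
def var (v : V) : Term V := mul v one

@[simp] theorem squarefree_one : (one : Term V).Squarefree := trivial

@[simp] theorem squarefree_var (v : V) : (var v).Squarefree := by simp [var, Squarefree, vars]

@[simp] theorem squarefree_add (s t : Term V) :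
    (add s t).Squarefree ↔ s.Squarefree ∧ t.Squarefree := Iff.rfl

@[simp] theorem squarefree_mul_var (u v : V) : (mul u (var v)).Squarefree ↔ u ≠ v := by
  simp [var, Squarefree, vars]

@[simp] theorem eval_one (f : V → ℕ) : one.eval f = 1 := rfl

@[simp] theorem eval_var (f : V → ℕ) (v : V) : (var v).eval f = f v := Nat.mul_one _

@[simp] theorem eval_add (f : V → ℕ) (s t : Term V) : (add s t).eval f = s.eval f + t.eval f := rfl

@[simp] theorem eval_mul (f : V → ℕ) (v : V) (t : Term V) : (mul v t).eval f = f v * t.eval f := rfl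

end Term

namespace Formula

variable {V : Type}

/-- Strict inequality. -/
def lt (s t : Term V) : Formula V := not (le t s)

/-- Equality. -/
def eq (s t : Term V) : Formula V := and (le s t) (le t s)

/-- Disjunction. -/
def or (φ ψ : Formula V) : Formula V := not (and (not φ) (not ψ))

/-- Implication. -/
def imp (φ ψ : Formula V) : Formula V := not (and φ (not ψ))

/-- Existential quantification. -/
def ex (v : V) (φ : Formula V) : Formula V := not (all v (not φ))

section

variable (s t : Term V) (a : Option Bool) (φ ψ : Formula V) (v : V)

@[simp] theorem bound_le : (le s t).bound = [] := rfl
@[simp] theorem bound_symbol : (symbol t a).bound = [] := rfl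
@[simp] theorem bound_lt : (lt s t).bound = [] := rfl
@[simp] theorem bound_eq : (eq s t).bound = [] := rfl
@[simp] theorem bound_not : (not φ).bound = φ.bound := rfl
@[simp] theorem bound_and : (and φ ψ).bound = φ.bound ++ ψ.bound := rfl
@[simp] theorem bound_or : (or φ ψ).bound = φ.bound ++ ψ.bound := rfl
@[simp] theorem bound_imp : (imp φ ψ).bound = φ.bound ++ ψ.bound := rfl
@[simp] theorem bound_all : (all v φ).bound = v :: φ.bound := rfl
@[simp] theorem bound_ex : (ex v φ).bound = v :: φ.bound := rfl

@[simp] theorem wellFormed_le : (le s t).WellFormed ↔ s.Squarefree ∧ t.Squarefree := Iff.rfl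
@[simp] theorem wellFormed_symbol : (symbol t a).WellFormed ↔ t.Squarefree := Iff.rfl
@[simp] theorem wellFormed_lt : (lt s t).WellFormed ↔ t.Squarefree ∧ s.Squarefree := Iff.rfl
@[simp] theorem wellFormed_eq : (eq s t).WellFormed ↔ s.Squarefree ∧ t.Squarefree := by
  simp [eq, WellFormed, and_comm]
@[simp] theorem wellFormed_not : (not φ).WellFormed ↔ φ.WellFormed := Iff.rfl
@[simp] theorem wellFormed_and : (and φ ψ).WellFormed ↔ φ.WellFormed ∧ ψ.WellFormed := Iff.rfl
@[simp] theorem wellFormed_or : (or φ ψ).WellFormed ↔ φ.WellFormed ∧ ψ.WellFormed := Iff.rfl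
@[simp] theorem wellFormed_imp : (imp φ ψ).WellFormed ↔ φ.WellFormed ∧ ψ.WellFormed := Iff.rfl
@[simp] theorem wellFormed_all : (all v φ).WellFormed ↔ v ∉ φ.bound ∧ φ.WellFormed := Iff.rfl
@[simp] theorem wellFormed_ex : (ex v φ).WellFormed ↔ v ∉ φ.bound ∧ φ.WellFormed := Iff.rfl

variable [DecidableEq V] (w : List (Option Bool)) (f : V → ℕ)

@[simp] theorem holds_le : (le s t).Holds w f ↔ s.eval f ≤ t.eval f := Iff.rfl
@[simp] theorem holds_symbol : (symbol t a).Holds w f ↔ w[t.eval f]? = some a := Iff.rfl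
@[simp] theorem holds_lt : (lt s t).Holds w f ↔ s.eval f < t.eval f := not_le
@[simp] theorem holds_eq : (eq s t).Holds w f ↔ s.eval f = t.eval f := le_antisymm_iff.symm
@[simp] theorem holds_not : (not φ).Holds w f ↔ ¬ φ.Holds w f := Iff.rfl
@[simp] theorem holds_and : (and φ ψ).Holds w f ↔ φ.Holds w f ∧ ψ.Holds w f := Iff.rfl
@[simp] theorem holds_or : (or φ ψ).Holds w f ↔ φ.Holds w f ∨ ψ.Holds w f := by
  simp only [or, holds_not, holds_and]; tauto
@[simp] theorem holds_imp : (imp φ ψ).Holds w f ↔ (φ.Holds w f → ψ.Holds w f) := by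
  simp only [imp, holds_not, holds_and]; tauto
@[simp] theorem holds_all :
    (all v φ).Holds w f ↔ ∀ i < w.length, φ.Holds w (update f v i) := Iff.rfl
@[simp] theorem holds_ex :
    (ex v φ).Holds w f ↔ ∃ i < w.length, φ.Holds w (update f v i) := by
  simp [ex]

end

end Formula

end StackProgram

/-! ### The verifier as a formula -/

namespace ColouringOrSubgraph

open StackProgram StackProgram.Formula StackProgram.Term Function

/-- The variables of the verifier: the positions `X` and `Y` of the separators, the number `n` of
vertices and a copy of it, the number `k` of colours or of vertices of the subgraph, and bound
variables. -/
inductive Var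
  | X | Y | n | n' | k | i | j | a | b | e | m
  deriving DecidableEq

namespace Var

instance : Fintype Var :=
  ⟨{X, Y, n, n', k, i, j, a, b, e, m}, fun v => by cases v <;> simp⟩

/-- The position of the entry `(u, v)` of the adjacency matrix. -/
def adjPos (u v : Var) : Term Var := add (add (var n) one) (add (mul u (var n)) (var v))

/-- The position of the entry `(u, v)` of the first table of the certificate. -/
def firstPos (u v : Var) : Term Var :=
  add (add (var X) one) (add (var X) (add (add (mul u (var X)) (mul u (var X))) (var v)))

/-- The position of the entry `(u, v)` of the second table of the certificate. -/
def secondPos (u v : Var) : Term Var :=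
  add (add (var X) one)
    (add (var X) (add (add (mul u (var X)) (mul u (var X))) (add (var X) (var v))))

/-- The position of the entry `(u, v)` of the table given by the challenge. -/
def challengePos (u v : Var) : Term Var := add (add (var Y) one) (add (mul u (var X)) (var v))

/-- The symbol at the given position is `1`. -/
def bit (t : Term Var) : Formula Var := symbol t (some true)

/-- The symbols at the positions `X` and `Y` are the separators. -/
def separators : Formula Var :=
  and (symbol (var X) none) (and (symbol (var Y) none) (lt (var X) (var Y)))

/-- The input is the encoding of a graph with `n` vertices. -/
def isGraph : Formula Var :=
  and (le one (var n)) <|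
  and (eq (var n) (var n')) <|
  -- The square of n is written with the copy `n'` because monomials must be squarefree.
  and (eq (var X) (add (add (var n) one) (mul n (var n')))) <|
  and (all i (imp (lt (var i) (var n)) (bit (var i)))) <|
  and (symbol (var n) (some false)) <|
  all i (imp (lt (var i) (var n)) (all j (imp (lt (var j) (var n)) (imp (bit (adjPos i j))
    (and (not (eq (var i) (var j))) (bit (adjPos j i)))))))

/-- The certificate starts with `k` ones and a zero. -/
def isCount : Formula Var :=
  and (all i (imp (lt (var i) (var k)) (bit (add (add (var X) one) (var i)))))
    (symbol (add (add (var X) one) (var k)) (some false))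

/-- Every entry `(e, m)` of the second table satisfies `m = 2 ^ e`. -/
def isPowerTable : Formula Var :=
  all e (imp (lt (var e) (var X)) (all m (imp (lt (var m) (var X)) (imp (bit (secondPos e m))
    -- Terms have no constant zero, so e = 0 is expressed as e + 1 = 1.
    (or (and (eq (add (var e) one) one) (eq (var m) one))
      (ex a (ex b (and (eq (var e) (add (var a) one)) (and (eq (var m) (add (var b) (var b)))
        (bit (secondPos a b)))))))))))

/-- Either `k = 0` or `2 ^ (k - 1) ^ 2 < n`. -/
def isSmall : Formula Var :=
  or (eq (add (var k) one) one)
    (ex a (ex b (ex e (ex m (and (eq (var a) (var b)) (and (eq (var k) (add (var a) one))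
      (and (eq (var e) (mul a (var b))) (and (lt (var e) (var X)) (and (lt (var m) (var n))
        (bit (secondPos e m)))))))))))

/-- The first table is a colouring with `k` colours. -/
def isColouring : Formula Var :=
  and (all i (imp (lt (var i) (var n)) (ex a (and (lt (var a) (var k)) (bit (firstPos i a)))))) <|
  all i (imp (lt (var i) (var n)) (all j (imp (lt (var j) (var n)) (all a (imp (lt (var a) (var k))
    (imp (bit (adjPos i j)) (imp (bit (firstPos i a)) (not (bit (firstPos j a))))))))))

/-- The first table is the adjacency matrix of a graph with `k` vertices. -/
def isSubgraph : Formula Var :=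
  all a (imp (lt (var a) (var k)) (all b (imp (lt (var b) (var k)) (imp (bit (firstPos a b))
    (and (not (eq (var a) (var b))) (bit (firstPos b a)))))))

/-- The challenge describes an embedding as an induced subgraph. -/
def isEmbedding : Formula Var :=
  and (all a (imp (lt (var a) (var k))
    (ex i (and (lt (var i) (var n)) (bit (challengePos a i)))))) <|
  all a (imp (lt (var a) (var k)) (all b (imp (lt (var b) (var k))
    (all i (imp (lt (var i) (var n)) (all j (imp (lt (var j) (var n))
      (imp (bit (challengePos a i)) (imp (bit (challengePos b j))
        (and (imp (eq (var a) (var b)) (eq (var i) (var j)))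
          (and (imp (eq (var i) (var j)) (eq (var a) (var b)))
            (and (imp (bit (adjPos i j)) (bit (firstPos a b)))
              (imp (bit (firstPos a b)) (bit (adjPos i j)))))))))))))))

/-- The verifier. -/
def verifier : Formula Var :=
  ex X (ex Y (ex n (ex n' (and separators (and isGraph (ex k (and isCount (and isPowerTable
    (and isSmall (or isColouring (and isSubgraph (not isEmbedding))))))))))))

theorem wellFormed_verifier : verifier.WellFormed := by
  simp [verifier, separators, isGraph, isCount, isPowerTable, isSmall, isColouring, isSubgraph,
    isEmbedding, bit, adjPos, firstPos, secondPos, challengePos]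

end Var

/-- The symbol of the word `w` at the position `p` is `1`. -/
def Bit (w : List (Option Bool)) (p : ℕ) : Prop := w[p]? = some (some true)

/-- The condition that the verifier checks. -/
def Verifies (w : List (Option Bool)) : Prop :=
  ∃ X < w.length, ∃ Y < w.length, ∃ n < w.length, ∃ n' < w.length,
    (w[X]? = some none ∧ w[Y]? = some none ∧ X < Y) ∧
    (1 ≤ n ∧ n = n' ∧ X = n + 1 + n * n' ∧
      (∀ i < w.length, i < n → Bit w i) ∧ w[n]? = some (some false) ∧
      ∀ i < w.length, i < n → ∀ j < w.length, j < n → Bit w (n + 1 + (i * n + j)) →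
        i ≠ j ∧ Bit w (n + 1 + (j * n + i))) ∧
    ∃ k < w.length,
      ((∀ i < w.length, i < k → Bit w (X + 1 + i)) ∧ w[X + 1 + k]? = some (some false)) ∧
      (∀ e < w.length, e < X → ∀ m < w.length, m < X →
        Bit w (X + 1 + (X + (e * X + e * X + (X + m)))) →
          e + 1 = 1 ∧ m = 1 ∨ ∃ a < w.length, ∃ b < w.length, e = a + 1 ∧ m = b + b ∧
            Bit w (X + 1 + (X + (a * X + a * X + (X + b))))) ∧
      (k + 1 = 1 ∨ ∃ a < w.length, ∃ b < w.length, ∃ e < w.length, ∃ m < w.length,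
        a = b ∧ k = a + 1 ∧ e = a * b ∧ e < X ∧ m < n ∧
          Bit w (X + 1 + (X + (e * X + e * X + (X + m))))) ∧
      (((∀ i < w.length, i < n →
          ∃ a < w.length, a < k ∧ Bit w (X + 1 + (X + (i * X + i * X + a)))) ∧
        ∀ i < w.length, i < n → ∀ j < w.length, j < n → ∀ a < w.length, a < k →
          Bit w (n + 1 + (i * n + j)) → Bit w (X + 1 + (X + (i * X + i * X + a))) →
            ¬ Bit w (X + 1 + (X + (j * X + j * X + a)))) ∨
      ((∀ a < w.length, a < k → ∀ b < w.length, b < k →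
          Bit w (X + 1 + (X + (a * X + a * X + b))) →
            a ≠ b ∧ Bit w (X + 1 + (X + (b * X + b * X + a)))) ∧
        ¬ ((∀ a < w.length, a < k → ∃ i < w.length, i < n ∧ Bit w (Y + 1 + (a * X + i))) ∧
          ∀ a < w.length, a < k → ∀ b < w.length, b < k →
            ∀ i < w.length, i < n → ∀ j < w.length, j < n →
              Bit w (Y + 1 + (a * X + i)) → Bit w (Y + 1 + (b * X + j)) →
                (a = b → i = j) ∧ (i = j → a = b) ∧
                (Bit w (n + 1 + (i * n + j)) → Bit w (X + 1 + (X + (a * X + a * X + b)))) ∧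
                (Bit w (X + 1 + (X + (a * X + a * X + b))) → Bit w (n + 1 + (i * n + j))))))

theorem holds_verifier_iff (w : List (Option Bool)) : Var.verifier.Holds w 0 ↔ Verifies w := by
  simp only [Var.verifier, Var.separators, Var.isGraph, Var.isCount, Var.isPowerTable, Var.isSmall,
    Var.isColouring, Var.isSubgraph, Var.isEmbedding, Var.bit, Var.adjPos, Var.firstPos,
    Var.secondPos, Var.challengePos, holds_le, holds_symbol, holds_lt, holds_eq, holds_not,
    holds_and, holds_or, holds_imp, holds_all, holds_ex, eval_one, eval_var, eval_add, eval_mul,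
    update_apply, reduceCtorEq, if_true, if_false]
  rfl

theorem isPolyTimePredicate_verifies [DecidablePred Verifies] :
    IsPolyTimePredicate fun w => decide (Verifies (encodeTriple w)) := by
  convert! Var.verifier.isPolyTimePredicate Var.wellFormed_verifier using 3 with w
  exact (holds_verifier_iff _).symm

end ColouringOrSubgraph

/-! ### Positions in encoded triples and encoded graphs -/

namespace ColouringOrSubgraph

section encodeTriple

variable (x y z : List Bool)

theorem length_encodeTriple :
    (encodeTriple (x, y, z)).length = x.length + y.length + z.length + 2 := by
  simp [encodeTriple]; omega

theorem encodeTriple_getElem?_left {p : ℕ} (hp : p < x.length) :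
    (encodeTriple (x, y, z))[p]? = x[p]?.map some := by
  rw [encodeTriple, List.getElem?_append_left (by simpa using hp), List.getElem?_map]

theorem encodeTriple_getElem?_fst : (encodeTriple (x, y, z))[x.length]? = some none := by
  simp [encodeTriple]

theorem encodeTriple_getElem?_middle {p : ℕ} (hp : p < y.length) :
    (encodeTriple (x, y, z))[x.length + 1 + p]? = y[p]?.map some := by
  rw [encodeTriple, List.getElem?_append_right (by simp; omega), List.length_map,
    show x.length + 1 + p - x.length = p + 1 by omega, List.getElem?_cons_succ,
    List.getElem?_append_left (by simpa using hp), List.getElem?_map]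

theorem encodeTriple_getElem?_snd :
    (encodeTriple (x, y, z))[x.length + 1 + y.length]? = some none := by
  rw [encodeTriple, List.getElem?_append_right (by simp; omega), List.length_map,
    show x.length + 1 + y.length - x.length = y.length + 1 by omega, List.getElem?_cons_succ]
  simp

theorem encodeTriple_getElem?_right (p : ℕ) :
    (encodeTriple (x, y, z))[x.length + 1 + y.length + 1 + p]? = z[p]?.map some := by
  rw [encodeTriple, List.getElem?_append_right (by simp; omega), List.length_map,
    show x.length + 1 + y.length + 1 + p - x.length = y.length + (p + 1) + 1 by omega,
    List.getElem?_cons_succ, List.getElem?_append_right (by simp), List.length_map,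
    Nat.add_sub_cancel_left, List.getElem?_cons_succ, List.getElem?_map]

/-- Only the two separators are `none`. With X < Y this makes the witnesses for X and Y in
`Verifies` unique. -/
theorem eq_or_eq_of_encodeTriple_getElem? {p : ℕ} (h : (encodeTriple (x, y, z))[p]? = some none) :
    p = x.length ∨ p = x.length + 1 + y.length := by
  by_contra! hp
  rcases lt_or_gt_of_ne hp.1 with h₁ | h₁
  · simp [encodeTriple_getElem?_left x y z h₁] at h
  rcases lt_or_gt_of_ne hp.2 with h₂ | h₂
  · obtain ⟨p, rfl⟩ := Nat.exists_eq_add_of_le (Nat.succ_le_of_lt h₁)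
    simp [encodeTriple_getElem?_middle x y z (show p < y.length by omega)] at h
  · obtain ⟨p, rfl⟩ := Nat.exists_eq_add_of_le (Nat.succ_le_of_lt h₂)
    simp [encodeTriple_getElem?_right] at h

theorem bit_left {p : ℕ} (hp : p < x.length) :
    Bit (encodeTriple (x, y, z)) p ↔ x[p]? = some true := by
  simp [Bit, encodeTriple_getElem?_left x y z hp]

theorem bit_middle {p : ℕ} (hp : p < y.length) :
    Bit (encodeTriple (x, y, z)) (x.length + 1 + p) ↔ y[p]? = some true := by
  simp [Bit, encodeTriple_getElem?_middle x y z hp]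

theorem bit_right (p : ℕ) :
    Bit (encodeTriple (x, y, z)) (x.length + 1 + y.length + 1 + p) ↔ z[p]? = some true := by
  simp [Bit, encodeTriple_getElem?_right]

end encodeTriple

section encodeGraph

variable {n : ℕ} (G : SimpleGraph (Fin n))

theorem getElem?_flatMap_finRange (f : Fin n → Fin n → Bool) (i j : Fin n) :
    ((List.finRange n).flatMap fun i => (List.finRange n).map (f i))[(i : ℕ) * n + j]? =
      some (f i j) := by
  have hf (i j : Fin n) (h : (i : ℕ) * n + j < n * n) :
      f (Fin.divNat ⟨(i : ℕ) * n + j, h⟩) (Fin.modNat ⟨(i : ℕ) * n + j, h⟩) = f i j := by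
    have hn : 0 < n := i.pos
    congr 1 <;> ext
    · rw [Fin.coe_divNat, Fin.val_mk, Nat.mul_comm, Nat.mul_add_div hn,
        Nat.div_eq_of_lt j.2, add_zero]
    · rw [Fin.coe_modNat, Fin.val_mk, Nat.mul_comm, Nat.mul_add_mod, Nat.mod_eq_of_lt j.2]
  have : ((List.finRange n).flatMap fun i => (List.finRange n).map (f i)) =
      List.ofFn fun p : Fin (n * n) => f p.divNat p.modNat := by
    simp only [List.ofFn_mul, List.flatMap_def, ← List.ofFn_eq_map, hf]
  have hlt : (i : ℕ) * n + j < n * n := by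
    have := Nat.mul_le_mul_right n (Nat.succ_le_of_lt i.2)
    rw [Nat.succ_mul] at this
    omega
  rw [this, List.getElem?_ofFn, dif_pos hlt, hf]

theorem length_encodeGraph : (encodeGraph G).length = n + 1 + n * n := by
  classical
  simp [encodeGraph]; omega

theorem encodeGraph_getElem?_unary {p : ℕ} (hp : p < n) : (encodeGraph G)[p]? = some true := by
  rw [encodeGraph, List.getElem?_append_left (by simpa using hp)]
  simp [hp]

theorem encodeGraph_getElem?_separator : (encodeGraph G)[n]? = some false := by
  rw [encodeGraph, List.getElem?_append_right (by simp)]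
  simp

open Classical in
theorem encodeGraph_getElem? (i j : Fin n) :
    (encodeGraph G)[n + 1 + (i * n + j)]? = some (decide (G.Adj i j)) := by
  rw [encodeGraph, List.getElem?_append_right (by simp; omega), List.length_replicate,
    show n + 1 + (i * n + j) - n = i * n + j + 1 by omega, List.getElem?_cons_succ,
    getElem?_flatMap_finRange]

theorem exists_eq_encodeGraph {x : List Bool} (hx : x.length = n + 1 + n * n)
    (h₁ : ∀ i < n, x[i]? = some true) (h₀ : x[n]? = some false)
    (h : ∀ i < n, ∀ j < n, x[n + 1 + (i * n + j)]? = some true →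
      i ≠ j ∧ x[n + 1 + (j * n + i)]? = some true) :
    ∃ G : SimpleGraph (Fin n), x = encodeGraph G := by
  let G : SimpleGraph (Fin n) :=
    { Adj := fun i j => x[n + 1 + ((i : ℕ) * n + j)]? = some true
      symm := ⟨fun i j hij => (h i i.2 j j.2 hij).2⟩
      loopless := ⟨fun i hi => (h i i.2 i i.2 hi).1 rfl⟩ }
  refine ⟨G, List.ext_getElem? fun p => ?_⟩
  rcases lt_or_ge p (n + 1 + n * n) with hp | hp
  · rcases lt_trichotomy p n with hpn | rfl | hpn
    · rw [h₁ p hpn, encodeGraph_getElem?_unary G hpn]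
    · rw [h₀, encodeGraph_getElem?_separator]
    · obtain ⟨r, rfl⟩ := Nat.exists_eq_add_of_le (Nat.succ_le_of_lt hpn)
      have hr : r < n * n := by simpa using hp
      have hn : 0 < n := by by_contra! h; simp [Nat.le_zero.1 h] at hr
      have := encodeGraph_getElem? G ⟨r / n, Nat.div_lt_of_lt_mul hr⟩ ⟨r % n, Nat.mod_lt _ hn⟩
      simp only [Nat.div_add_mod'] at this
      rw [Nat.succ_eq_add_one, this]
      have hlt : n + 1 + r < x.length := by omega
      simp only [G, Nat.div_add_mod', List.getElem?_eq_getElem hlt]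
      cases x[n + 1 + r] <;> simp
  · rw [List.getElem?_eq_none (by omega),
      List.getElem?_eq_none (by rw [length_encodeGraph]; exact hp)]

end encodeGraph

/-- The lists of bits with a given set of positions of ones. -/
theorem exists_list_getElem? (N : ℕ) (S : ℕ → Prop) :
    ∃ l : List Bool, l.length = N ∧ (∀ p < N, l[p]? = some true ↔ S p) ∧
      ∀ p < N, l[p]? = some false ↔ ¬ S p := by
  classical
  exact ⟨(List.range N).map fun p => decide (S p), by simp, fun p hp => by simp [hp],
    fun p hp => by simp [hp]⟩

/-- For k = a + 1 the inequality says a < √(log₂ n), that is, a² < log₂ n. This turns the bound into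
a statement about natural numbers that a table of powers of two can certify. -/
theorem le_ceilSqrtLog_iff {n : ℕ} (hn : 0 < n) (k : ℕ) :
    k ≤ ceilSqrtLog n ↔ k = 0 ∨ ∃ a, k = a + 1 ∧ 2 ^ (a * a) < n := by
  rcases k with _ | a
  · simp
  have hn' : (0 : ℝ) < n := by exact_mod_cast hn
  have : a + 1 ≤ ceilSqrtLog n ↔ 2 ^ (a * a) < n := by
    rw [Nat.add_one_le_iff, ceilSqrtLog, Nat.lt_ceil, Real.lt_sqrt (Nat.cast_nonneg a),
      Real.lt_logb_iff_rpow_lt one_lt_two hn', ← @Nat.cast_lt ℝ, sq, ← Nat.cast_mul,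
      Real.rpow_natCast]
    simp
  simp [this]

/-- For colourings k = p suffices, and fewer colours are allowed by monotonicity. For subgraphs k is
the exact number of vertices of H, whose vertex set is transported to `Fin k`. -/
theorem isYesInstance_iff {n : ℕ} (hn : 0 < n) (G : SimpleGraph (Fin n)) :
    IsYesInstance G ↔ ∃ k, (k = 0 ∨ ∃ a, k = a + 1 ∧ 2 ^ (a * a) < n) ∧
      (G.Colorable k ∨ ∃ H : SimpleGraph (Fin k), IsInducedFree H G) := by
  simp only [← le_ceilSqrtLog_iff hn, IsYesInstance, Fintype.card_fin]
  constructor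
  · rintro (h | ⟨W, _, H, hW, h⟩)
    · exact ⟨_, le_rfl, .inl h⟩
    · let e := Fintype.equivFin W
      refine ⟨_, hW, .inr ⟨H.map e.toEmbedding, fun ⟨f⟩ => h ⟨?_⟩⟩⟩
      exact f.comp (SimpleGraph.Iso.map e H).toEmbedding
  · rintro ⟨k, hk, h | ⟨H, h⟩⟩
    · exact .inl (h.mono hk)
    · exact .inr ⟨Fin k, inferInstance, H, by simpa using hk, h⟩

end ColouringOrSubgraph

/-! ### The verifier's condition in terms of graphs and tables -/

namespace ColouringOrSubgraph

/-- The first table in a certificate. -/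
def First (y : List Bool) (L a b : ℕ) : Prop := y[L + (a * L + a * L + b)]? = some true

/-- The second table in a certificate. -/
def Second (y : List Bool) (L a b : ℕ) : Prop := y[L + (a * L + a * L + (L + b))]? = some true

/-- The table in a challenge. -/
def Challenge (z : List Bool) (L a b : ℕ) : Prop := z[a * L + b]? = some true

/-- The certificate encodes the number `k` and a table of powers of two that witnesses that `k` is
at most `⌈√(log₂ n)⌉`. -/
def IsCount (y : List Bool) (L n k : ℕ) : Prop :=
  ((∀ i < k, y[i]? = some true) ∧ y[k]? = some false) ∧
  (∀ e < L, ∀ m < L, Second y L e m →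
    e = 0 ∧ m = 1 ∨ ∃ a b, e = a + 1 ∧ m = b + b ∧ Second y L a b) ∧
  (k = 0 ∨ ∃ a m, k = a + 1 ∧ a * a < L ∧ m < n ∧ Second y L (a * a) m)

/-- The certificate encodes a colouring of `G`. -/
def IsColouring {n : ℕ} (G : SimpleGraph (Fin n)) (y : List Bool) (L k : ℕ) : Prop :=
  (∀ i : Fin n, ∃ a < k, First y L i a) ∧
  ∀ i j : Fin n, ∀ a < k, G.Adj i j → First y L i a → ¬ First y L j a

/-- The certificate encodes a graph with `k` vertices. -/
def IsSubgraph (y : List Bool) (L k : ℕ) : Prop :=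
  ∀ a < k, ∀ b < k, First y L a b → a ≠ b ∧ First y L b a

/-- The challenge encodes an embedding of the graph in the certificate. -/
def IsEmbedding {n : ℕ} (G : SimpleGraph (Fin n)) (y z : List Bool) (L k : ℕ) : Prop :=
  (∀ a < k, ∃ i : Fin n, Challenge z L a i) ∧
  ∀ a < k, ∀ b < k, ∀ i j : Fin n, Challenge z L a i → Challenge z L b j →
    (a = b → i = j) ∧ (i = j → a = b) ∧
    (G.Adj i j → First y L a b) ∧ (First y L a b → G.Adj i j)

/-- Rows have width L in the challenge (d = 1) and 2L in the certificate (d = 2), where each row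
holds a row of the first table followed by a row of the second. -/
theorem row_lt {L a b c d : ℕ} (ha : a < L) (hc : c = d * L) (hb : b < d * L) :
    a * c + b < d * (L * L) := by
  subst hc
  calc a * (d * L) + b < (a + 1) * (d * L) := by rw [Nat.succ_mul]; omega
    _ ≤ L * (d * L) := Nat.mul_le_mul_right _ ha
    _ = d * (L * L) := by ring

theorem first_lt {L a b : ℕ} (ha : a < L) (hb : b < L) :
    L + (a * L + a * L + b) < 2 * (L * L) + L := by
  have := row_lt ha (d := 2) rfl (show b < 2 * L by omega)
  have : a * (2 * L) = a * L + a * L := by ring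
  omega

theorem second_lt {L a b : ℕ} (ha : a < L) (hb : b < L) :
    L + (a * L + a * L + (L + b)) < 2 * (L * L) + L := by
  have := row_lt ha (d := 2) rfl (show L + b < 2 * L by omega)
  have : a * (2 * L) = a * L + a * L := by ring
  omega

variable {x y z : List Bool}

theorem exists_of_verifies (hy : y.length = 2 * (x.length * x.length) + x.length)
    (h : Verifies (encodeTriple (x, y, z))) :
    ∃ (n : ℕ) (G : SimpleGraph (Fin n)) (k : ℕ), 0 < n ∧ x = encodeGraph G ∧
      IsCount y x.length n k ∧ (IsColouring G y x.length k ∨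
        IsSubgraph y x.length k ∧ ¬ IsEmbedding G y z x.length k) := by
  obtain ⟨X, -, Y, -, n, -, n', -, ⟨hX, hY, hXY⟩, ⟨hn, rfl, hx, hone, hzero, hadj⟩, k, hk,
    ⟨hcount, hcount₀⟩, hpow, hsmall, hmain⟩ := h
  have hX' := eq_or_eq_of_encodeTriple_getElem? x y z hX
  have hY' := eq_or_eq_of_encodeTriple_getElem? x y z hY
  obtain ⟨rfl, rfl⟩ : X = x.length ∧ Y = x.length + 1 + y.length := by
    clear hsmall
    omega
  clear hX hY hX' hY' hXY
  have hlen := length_encodeTriple x y z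
  have hposn {i j : ℕ} (hi : i < n) (hj : j < n) : n + 1 + (i * n + j) < x.length := by
    have := row_lt hi (d := 1) (Nat.one_mul n).symm (show j < 1 * n by omega)
    omega
  obtain ⟨G, rfl⟩ : ∃ G : SimpleGraph (Fin n), x = encodeGraph G := by
    refine exists_eq_encodeGraph hx (fun i hi => ?_) ?_ fun i hi j hj hij => ?_
    · exact (bit_left x y z (by omega)).1 (hone i (by omega) hi)
    · simpa [encodeTriple_getElem?_left x y z (show n < x.length by omega)] using hzero
    · rw [← bit_left x y z (hposn hi hj)] at hij
      rw [← bit_left x y z (hposn hj hi)]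
      exact hadj i (by omega) hi j (by omega) hj hij
  generalize hL : (encodeGraph G).length = L at *
  have hA (i j : Fin n) :
      Bit (encodeTriple (encodeGraph G, y, z)) (n + 1 + (i * n + j)) ↔ G.Adj i j := by
    rw [bit_left _ y z (by rw [hL]; exact hposn i.2 j.2), encodeGraph_getElem?]
    simp
  have hF {a b : ℕ} (ha : a < L) (hb : b < L) : Bit (encodeTriple (encodeGraph G, y, z))
      (L + 1 + (L + (a * L + a * L + b))) ↔ First y L a b := by
    rw [← hL, bit_middle _ y z (by rw [hL, hy]; exact first_lt ha hb)]
    rfl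
  have hS {a b : ℕ} (ha : a < L) (hb : b < L) : Bit (encodeTriple (encodeGraph G, y, z))
      (L + 1 + (L + (a * L + a * L + (L + b)))) ↔ Second y L a b := by
    rw [← hL, bit_middle _ y z (by rw [hL, hy]; exact second_lt ha hb)]
    rfl
  have hZ (a b : ℕ) : Bit (encodeTriple (encodeGraph G, y, z))
      (L + 1 + y.length + 1 + (a * L + b)) ↔ Challenge z L a b := by
    rw [← hL, bit_right]
    rfl
  -- The ones and the closing zero that encode k cannot run past the separator after y.
  have hky : k < y.length := by
    by_contra! hky
    rcases hky.eq_or_lt with hky | hky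
    · rw [← hky, ← hL, encodeTriple_getElem?_snd] at hcount₀
      simp at hcount₀
    · have := hcount y.length (by omega) hky
      rw [← hL, Bit, encodeTriple_getElem?_snd] at this
      simp at this
  -- If k = a + 1, the smallness clause gives a ≤ a² < L; thus indices below k stay inside the
  -- tables.
  have hkL : k ≤ L := by
    rcases hsmall with hk | ⟨a, -, b, -, e, -, m, -, rfl, rfl, rfl, he, -⟩
    · omega
    · have := Nat.le_mul_self a
      omega
  refine ⟨n, G, k, hn, rfl, ⟨⟨fun i hi => ?_, ?_⟩, fun e he m hm hem => ?_, ?_⟩, ?_⟩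
  · rw [← bit_middle _ y z (by omega), hL]
    exact hcount i (by omega) hi
  · rw [← hL, encodeTriple_getElem?_middle _ y z hky] at hcount₀
    simpa using hcount₀
  · rcases hpow e (by omega) he m (by omega) hm ((hS he hm).2 hem) with
      h | ⟨a, -, b, -, rfl, rfl, hab⟩
    · exact .inl (by omega)
    · exact .inr ⟨a, b, rfl, rfl, (hS (by omega) (by omega)).1 hab⟩
  · rcases hsmall with hk | ⟨a, -, b, -, e, -, m, -, rfl, rfl, rfl, he, hm, hem⟩
    · exact .inl (by omega)
    · exact .inr ⟨a, m, rfl, he, hm, (hS he (by omega)).1 hem⟩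
  · refine hmain.imp (fun ⟨h, h'⟩ => ⟨fun i => ?_, fun i j a ha hij hia hja => ?_⟩)
      fun ⟨h, h'⟩ => ⟨fun a ha b hb hab => ?_, fun ⟨g, g'⟩ => h' ⟨fun a _ ha => ?_,
        fun a _ ha b _ hb i _ hi j _ hj hai hbj => ?_⟩⟩
    · obtain ⟨a, -, ha, hia⟩ := h i (by omega) i.2
      exact ⟨a, ha, (hF (by omega) (by omega)).1 hia⟩
    · exact h' i (by omega) i.2 j (by omega) j.2 a (by omega) ha ((hA i j).2 hij)
        ((hF (by omega) (by omega)).2 hia) ((hF (by omega) (by omega)).2 hja)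
    · rw [← hF (by omega) (by omega)] at hab ⊢
      exact h a (by omega) ha b (by omega) hb hab
    · obtain ⟨i, hi⟩ := g a ha
      exact ⟨i, by omega, i.2, (hZ a i).2 hi⟩
    · have := g' a ha b hb ⟨i, hi⟩ ⟨j, hj⟩ ((hZ a i).1 hai) ((hZ b j).1 hbj)
      rw [hF (by omega) (by omega), hA ⟨i, hi⟩ ⟨j, hj⟩]
      simpa using this

theorem verifies_of_isCount {n : ℕ} (G : SimpleGraph (Fin n)) {k : ℕ} (hn : 0 < n)
    (hx : x = encodeGraph G)
    (hy : y.length = 2 * (x.length * x.length) + x.length)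
    (hk : IsCount y x.length n k) (h : IsColouring G y x.length k ∨
        IsSubgraph y x.length k ∧ ¬ IsEmbedding G y z x.length k) :
    Verifies (encodeTriple (x, y, z)) := by
  subst hx
  have hlen := length_encodeTriple (encodeGraph G) y z
  have hx := length_encodeGraph G
  have hfst := encodeTriple_getElem?_fst (encodeGraph G) y z
  have hsnd := encodeTriple_getElem?_snd (encodeGraph G) y z
  have hleft (p) := bit_left (encodeGraph G) y z (p := p)
  have hmiddle (p) := bit_middle (encodeGraph G) y z (p := p)
  have hmiddle' (p) := encodeTriple_getElem?_middle (encodeGraph G) y z (p := p)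
  have hright (p) := bit_right (encodeGraph G) y z (p := p)
  have hzero := encodeTriple_getElem?_left (encodeGraph G) y z (p := n) (by omega)
  rw [encodeGraph_getElem?_separator] at hzero
  generalize hL : (encodeGraph G).length = L at *
  have hposn {i j : ℕ} (hi : i < n) (hj : j < n) : n + 1 + (i * n + j) < L := by
    have := row_lt hi (d := 1) (Nat.one_mul n).symm (show j < 1 * n by omega)
    omega
  have hA {i j : ℕ} (hi : i < n) (hj : j < n) :
      Bit (encodeTriple (encodeGraph G, y, z)) (n + 1 + (i * n + j)) ↔ G.Adj ⟨i, hi⟩ ⟨j, hj⟩ := by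
    rw [hleft _ (hposn hi hj), encodeGraph_getElem? G ⟨i, hi⟩ ⟨j, hj⟩]
    simp
  have hF {a b : ℕ} (ha : a < L) (hb : b < L) : Bit (encodeTriple (encodeGraph G, y, z))
      (L + 1 + (L + (a * L + a * L + b))) ↔ First y L a b :=
    hmiddle _ (by rw [hy]; exact first_lt ha hb)
  have hS {a b : ℕ} (ha : a < L) (hb : b < L) : Bit (encodeTriple (encodeGraph G, y, z))
      (L + 1 + (L + (a * L + a * L + (L + b)))) ↔ Second y L a b :=
    hmiddle _ (by rw [hy]; exact second_lt ha hb)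
  have hZ (a b : ℕ) : Bit (encodeTriple (encodeGraph G, y, z))
      (L + 1 + y.length + 1 + (a * L + b)) ↔ Challenge z L a b := hright _
  obtain ⟨⟨hcount, hcount₀⟩, hpow, hsmall⟩ := hk
  have hky : k < y.length := (List.getElem?_eq_some_iff.1 hcount₀).1
  have hkL : k ≤ L := by
    rcases hsmall with hk | ⟨a, m, rfl, ha, -⟩
    · omega
    · have := Nat.le_mul_self a
      omega
  refine ⟨L, by omega, L + 1 + y.length, by omega, n, by omega, n, by omega, ⟨hfst, hsnd, by omega⟩,
    ⟨hn, rfl, hx, fun i _ hi => ?_, hzero, fun i _ hi j _ hj hij => ?_⟩, k, by omega,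
    ⟨fun i _ hi => ?_, ?_⟩, fun e _ he m _ hm hem => ?_, ?_, ?_⟩
  · rw [hleft _ (by omega), encodeGraph_getElem?_unary G hi]
  · rw [hA hi hj] at hij
    rw [hA hj hi]
    exact ⟨fun e => hij.ne (by simp [e]), hij.symm⟩
  · rw [hmiddle _ (by omega)]
    exact hcount i hi
  · rw [hmiddle' _ hky, hcount₀]
    rfl
  · rcases hpow e he m hm ((hS he hm).1 hem) with h | ⟨a, b, rfl, rfl, hab⟩
    · exact .inl (by omega)
    · exact .inr ⟨a, by omega, b, by omega, rfl, rfl, (hS (by omega) (by omega)).2 hab⟩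
  · rcases hsmall with hk | ⟨a, m, rfl, ha, hm, hab⟩
    · exact .inl (by omega)
    · have := Nat.le_mul_self a
      exact .inr ⟨a, by omega, a, by omega, a * a, by omega, m, by omega, rfl, rfl, rfl, ha, hm,
        (hS ha (by omega)).2 hab⟩
  · refine h.imp (fun ⟨h, h'⟩ => ⟨fun i _ hi => ?_, fun i _ hi j _ hj a _ ha hij hia hja => ?_⟩)
      fun ⟨h, h'⟩ => ⟨fun a _ ha b _ hb hab => ?_, fun ⟨g, g'⟩ => h' ⟨fun a ha => ?_,
        fun a ha b hb i j hai hbj => ?_⟩⟩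
    · obtain ⟨a, ha, hia⟩ := h ⟨i, hi⟩
      exact ⟨a, by omega, ha, (hF (by omega) (by omega)).2 hia⟩
    · exact h' ⟨i, hi⟩ ⟨j, hj⟩ a ha ((hA hi hj).1 hij)
        ((hF (by omega) (by omega)).1 hia) ((hF (by omega) (by omega)).1 hja)
    · rw [hF (by omega) (by omega)] at hab ⊢
      exact h a ha b hb hab
    · obtain ⟨i, -, hi, hai⟩ := g a (by omega) ha
      exact ⟨⟨i, hi⟩, (hZ a i).1 hai⟩
    · have := g' a (by omega) ha b (by omega) hb i (by omega) i.2 j (by omega) j.2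
        ((hZ a i).2 hai) ((hZ b j).2 hbj)
      rw [hF (by omega) (by omega), hA i.2 j.2] at this
      simpa [Fin.ext_iff] using this

end ColouringOrSubgraph

/-! ### Soundness and completeness of the verifier -/

namespace ColouringOrSubgraph

variable {y z : List Bool} {L n k : ℕ}

/-- Induction on e: a nonzero e leads back to an entry (e - 1, m / 2). The table need not be
complete; it only must contain no wrong entry. -/
theorem Second.eq_two_pow
    (h : ∀ e < L, ∀ m < L, Second y L e m →
      e = 0 ∧ m = 1 ∨ ∃ a b, e = a + 1 ∧ m = b + b ∧ Second y L a b) :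
    ∀ e < L, ∀ m < L, Second y L e m → m = 2 ^ e := by
  intro e
  induction e with
  | zero =>
    intro he m hm hem
    rcases h 0 he m hm hem with ⟨-, rfl⟩ | ⟨a, b, h0, -⟩
    · rfl
    · omega
  | succ e ih =>
    intro he m hm hem
    rcases h _ he m hm hem with ⟨h0, -⟩ | ⟨a, b, ha, rfl, hab⟩
    · omega
    · obtain rfl : e = a := by omega
      rw [ih (by omega) b (by omega) hab]
      ring

theorem IsCount.small (h : IsCount y L n k) (hn : n ≤ L) :
    k = 0 ∨ ∃ a, k = a + 1 ∧ 2 ^ (a * a) < n := by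
  rcases h.2.2 with hk | ⟨a, m, hk, ha, hm, ham⟩
  · exact .inl hk
  · have := Second.eq_two_pow h.2.1 _ ha m (by omega) ham
    exact .inr ⟨a, hk, this ▸ hm⟩

/-- The number k is the position of the first zero of y. Hence runs of the verifier on different
challenges use the same k. -/
theorem IsCount.unique {k' n' : ℕ} (h : IsCount y L n k) (h' : IsCount y L n' k') : k = k' := by
  rcases lt_trichotomy k k' with hk | hk | hk
  · have := h'.1.1 k hk
    simp [h.1.2] at this
  · exact hk
  · have := h.1.1 k' hk
    simp [h'.1.2] at this

theorem le_of_small (h : k = 0 ∨ ∃ a, k = a + 1 ∧ 2 ^ (a * a) < n) : k ≤ n := by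
  rcases h with rfl | ⟨a, rfl, ha⟩
  · exact Nat.zero_le _
  · have := Nat.le_mul_self a
    have := Nat.lt_two_pow_self (n := a * a)
    omega

/-- After L leading bits come L rows of width 2L, with `C` in the left halves and the graph of e ↦ 2
^ e in the right halves. Since k ≤ n < L, the unary code of k and its closing zero fit into the
leading bits. The exponent needed lies in the table because a² < 2 ^ a² < n < L. -/
theorem exists_certificate (hnL : n < L) (hk : k = 0 ∨ ∃ a, k = a + 1 ∧ 2 ^ (a * a) < n)
    (C : ℕ → ℕ → Prop) :
    ∃ y : List Bool, y.length = 2 * (L * L) + L ∧ IsCount y L n k ∧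
      ∀ a < L, ∀ b < L, First y L a b ↔ C a b := by
  have hkn := le_of_small hk
  obtain ⟨y, hy, h₁, h₀⟩ := exists_list_getElem? (2 * (L * L) + L) fun p => p < k ∨ L ≤ p ∧
    if (p - L) % (2 * L) < L then C ((p - L) / (2 * L)) ((p - L) % (2 * L))
    else (p - L) % (2 * L) - L = 2 ^ ((p - L) / (2 * L))
  have hmul (a : ℕ) : a * L + a * L = 2 * L * a := by ring
  have hC : ∀ a < L, ∀ b < L, First y L a b ↔ C a b := fun a ha b hb => by
    rw [First, h₁ _ (first_lt ha hb), Nat.add_sub_cancel_left, hmul,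
      Nat.mul_add_div (by omega), Nat.mul_add_mod, Nat.mod_eq_of_lt (show b < 2 * L by omega),
      Nat.div_eq_of_lt (show b < 2 * L by omega), if_pos hb, add_zero]
    exact ⟨fun h => (h.resolve_left (by omega)).2, fun h => .inr ⟨by omega, h⟩⟩
  have hE : ∀ a < L, ∀ b < L, Second y L a b ↔ b = 2 ^ a := fun a ha b hb => by
    rw [Second, h₁ _ (second_lt ha hb), Nat.add_sub_cancel_left, hmul,
      Nat.mul_add_div (by omega), Nat.mul_add_mod, Nat.mod_eq_of_lt (show L + b < 2 * L by omega),
      Nat.div_eq_of_lt (show L + b < 2 * L by omega), if_neg (by omega), add_zero,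
      Nat.add_sub_cancel_left]
    exact ⟨fun h => (h.resolve_left (by omega)).2, fun h => .inr ⟨by omega, h⟩⟩
  refine ⟨y, hy, ⟨⟨fun i hi => (h₁ i (by omega)).2 (.inl hi), (h₀ k (by omega)).2 (by omega)⟩,
    fun e he m hm hem => ?_, hk.imp id ?_⟩, hC⟩
  · rw [hE e he m hm] at hem
    rcases e with _ | e
    · exact .inl ⟨rfl, by simpa using hem⟩
    · have hm' : m = 2 ^ e + 2 ^ e := by rw [hem]; ring
      exact .inr ⟨e, 2 ^ e, rfl, hm', (hE _ (by omega) _ (by omega)).2 rfl⟩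
  · rintro ⟨a, rfl, ha⟩
    have := Nat.lt_two_pow_self (n := a * a)
    exact ⟨a, _, rfl, by omega, ha, (hE _ (by omega) _ (by omega)).2 rfl⟩

theorem exists_challenge (hnL : n ≤ L) (hkL : k ≤ L) (f : Fin k → Fin n) :
    ∃ z : List Bool, z.length = 2 * (L * L) + L ∧
      ∀ (a : Fin k) (i : Fin n), Challenge z L a i ↔ i = f a := by
  obtain ⟨z, hz, h₁, -⟩ := exists_list_getElem? (2 * (L * L) + L) fun p =>
    ∃ h : p / L < k, p % L = f ⟨_, h⟩
  refine ⟨z, hz, fun a i => ?_⟩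
  have hlt : a * L + i < 2 * (L * L) + L := by
    have := row_lt (show (a : ℕ) < L by omega) (d := 1) (Nat.one_mul L).symm
      (show (i : ℕ) < 1 * L by omega)
    omega
  have hdiv : (a * L + i) / L = (a : ℕ) := by
    rw [Nat.mul_comm, Nat.mul_add_div (by omega), Nat.div_eq_of_lt (by omega), add_zero]
  have hmod : (a * L + i) % L = (i : ℕ) := by
    rw [Nat.mul_comm, Nat.mul_add_mod, Nat.mod_eq_of_lt (by omega)]
  rw [Challenge, h₁ _ hlt]
  simp only [hdiv, hmod, a.2, exists_true_left, Fin.ext_iff]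

/-- A table may give a vertex several colours, but adjacent vertices share none of them, so any
choice of one colour per vertex is proper. -/
theorem IsColouring.colorable {G : SimpleGraph (Fin n)} (h : IsColouring G y L k) :
    G.Colorable k := by
  choose c hc hc' using h.1
  exact ⟨SimpleGraph.Coloring.mk (fun i => (⟨c i, hc i⟩ : Fin k)) fun {i j} hij e =>
    h.2 i j (c i) (hc i) hij (hc' i) (by rw [Fin.mk.inj e]; exact hc' j)⟩

theorem eq_of_encodeGraph_eq {n' : ℕ} {G : SimpleGraph (Fin n)} {G' : SimpleGraph (Fin n')}
    (h : encodeGraph G = encodeGraph G') : n = n' ∧ G ≍ G' := by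
  have hl := congrArg List.length h
  rw [length_encodeGraph, length_encodeGraph] at hl
  -- The length n + 1 + n² is strictly increasing in n.
  obtain rfl : n = n' := by nlinarith
  refine ⟨rfl, heq_of_eq ?_⟩
  ext i j
  have := encodeGraph_getElem? G i j
  rw [h, encodeGraph_getElem?] at this
  simpa using this.symm

/-- For each challenge the verifier yields its own graph and k, but these are determined by x and y,
as is whether y holds a colouring. If it does not, y holds a graph H, and an embedding of H into G
would itself be a challenge that the verifier rejects. -/
theorem mem_of_verifies {x : List Bool}
    (hy : y.length = 2 * (x.length * x.length) + x.length)
    (h : ∀ z : List Bool, z.length = 2 * (x.length * x.length) + x.length →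
      Verifies (encodeTriple (x, y, z))) : x ∈ ColouringOrSubgraph := by
  obtain ⟨n, G, k, hn, rfl, hcount, hmain⟩ :=
    -- Any challenge of the right length would do here: only the data determined by x and y are
    -- extracted.
    exists_of_verifies hy (h (List.replicate _ false) List.length_replicate)
  have hnL : n < (encodeGraph G).length := by rw [length_encodeGraph]; omega
  have hsmall := hcount.small hnL.le
  have hkn := le_of_small hsmall
  refine ⟨n, hn, G, (isYesInstance_iff hn G).2 ⟨k, hsmall, ?_⟩, rfl⟩
  by_cases hcol : IsColouring G y (encodeGraph G).length k
  · exact .inl hcol.colorable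
  have hsub := (hmain.resolve_left hcol).1
  let H : SimpleGraph (Fin k) :=
    { Adj := fun a b => First y (encodeGraph G).length a b
      symm := ⟨fun a b hab => (hsub a a.2 b b.2 hab).2⟩
      loopless := ⟨fun a ha => (hsub a a.2 a a.2 ha).1 rfl⟩ }
  refine .inr ⟨H, fun ⟨f⟩ => ?_⟩
  obtain ⟨z, hz, hZ⟩ := exists_challenge hnL.le (hkn.trans hnL.le) f
  obtain ⟨n', G', k', -, hG, hcount', hmain'⟩ := exists_of_verifies hy (h z hz)
  obtain ⟨rfl, hG'⟩ := eq_of_encodeGraph_eq hG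
  obtain rfl := eq_of_heq hG'
  obtain rfl := hcount.unique hcount'
  have hsub' (a b : Fin k) : First y (encodeGraph G).length a b ↔ G.Adj (f a) (f b) :=
    f.map_rel_iff.symm
  refine (hmain'.resolve_left hcol).2 ⟨fun a ha => ⟨f ⟨a, ha⟩, (hZ ⟨a, ha⟩ _).2 rfl⟩,
    fun a ha b hb i j hai hbj => ?_⟩
  obtain rfl := (hZ ⟨a, ha⟩ i).1 hai
  obtain rfl := (hZ ⟨b, hb⟩ j).1 hbj
  have := hsub' ⟨a, ha⟩ ⟨b, hb⟩
  exact ⟨fun e => by simp [e], fun e => Fin.mk.inj (f.injective e), this.2, this.1⟩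

theorem exists_verifies_of_mem {x : List Bool} (hx : x ∈ ColouringOrSubgraph) :
    ∃ y : List Bool, y.length = 2 * (x.length * x.length) + x.length ∧
      ∀ z : List Bool, Verifies (encodeTriple (x, y, z)) := by
  obtain ⟨n, hn, G, hG, rfl⟩ := hx
  obtain ⟨k, hsmall, hG⟩ := (isYesInstance_iff hn G).1 hG
  have hnL : n < (encodeGraph G).length := by rw [length_encodeGraph]; omega
  have hkn := le_of_small hsmall
  rcases hG with ⟨⟨c⟩⟩ | ⟨H, hH⟩
  · obtain ⟨y, hy, hcount, hC⟩ := exists_certificate hnL hsmall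
      fun i a => ∃ h : i < n, (c ⟨i, h⟩ : ℕ) = a
    refine ⟨y, hy, fun z => verifies_of_isCount G hn rfl hy hcount (.inl ⟨fun i =>
      ⟨c i, (c i).2, (hC _ (by omega) _ (by omega)).2 ⟨i.2, rfl⟩⟩, fun i j a ha hij hi hj => ?_⟩)⟩
    obtain ⟨_, hi⟩ := (hC _ (by omega) _ (by omega)).1 hi
    obtain ⟨_, hj⟩ := (hC _ (by omega) _ (by omega)).1 hj
    exact c.valid hij (Fin.ext (hi.trans hj.symm))
  · obtain ⟨y, hy, hcount, hC⟩ := exists_certificate hnL hsmall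
      fun a b => ∃ (ha : a < k) (hb : b < k), H.Adj ⟨a, ha⟩ ⟨b, hb⟩
    refine ⟨y, hy, fun z => verifies_of_isCount G hn rfl hy hcount (.inr ⟨fun a ha b hb hab => ?_,
      fun ⟨h, h'⟩ => hH ?_⟩)⟩
    · obtain ⟨_, _, hab⟩ := (hC _ (by omega) _ (by omega)).1 hab
      exact ⟨fun e => hab.ne (by simp [e]),
        (hC _ (by omega) _ (by omega)).2 ⟨hb, ha, hab.symm⟩⟩
    -- An accepted embedding relation is turned into a map by choosing one image per vertex; the
    -- clauses on pairs make it injective and make it preserve and reflect adjacency, contradicting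
    -- H-freeness.
    · choose f hf using fun a : Fin k => h a a.2
      have hf' (a b : Fin k) := h' a a.2 b b.2 (f a) (f b) (hf a) (hf b)
      refine ⟨⟨⟨f, fun a b e => Fin.ext ((hf' a b).2.1 e)⟩, fun {a b} =>
        ⟨fun hab => ?_, fun hab => ?_⟩⟩⟩
      · exact ((hC _ (by omega) _ (by omega)).1 ((hf' a b).2.2.1 hab)).2.2
      · exact (hf' a b).2.2.2 ((hC _ (by omega) _ (by omega)).2 ⟨a.2, b.2, hab⟩)

end ColouringOrSubgraph

theorem theorem2 : ColouringOrSubgraph ∈ SigmaP2 := by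
  classical
  refine ⟨_, .C 2 * (.X * .X) + .X, ColouringOrSubgraph.isPolyTimePredicate_verifies, fun x => ?_⟩
  simp only [Polynomial.eval_add, Polynomial.eval_mul, Polynomial.eval_C, Polynomial.eval_X,
    decide_eq_true_eq]
  constructor
  · intro hx
    obtain ⟨y, hy, h⟩ := ColouringOrSubgraph.exists_verifies_of_mem hx
    exact ⟨y, hy, fun z _ => h z⟩
  · rintro ⟨y, hy, h⟩
    exact ColouringOrSubgraph.mem_of_verifies hy h
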